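/- **Setting.** Let $n=k^D$ with $k\ge 3$, so $D=\log_k n$. The servers are the $n$ words $x\in[k]^D$, and server $x$ emulates the nodes $(0,x),\dots,(D,x)$ of the $k$-ary butterfly, in which $(i,x)$ and $(i+1,y)$ are adjacent iff $x,y$ agree outside coordinate $i+1$. Data items are identified with their keys from a set $U$ of bit strings of a common length $\Lambda$, $m=|U|$. For a zone $z\in\{0,\dots,\Lambda\}$ the bucket of $d$ is given by the first $z$ address bits of $d$. Each bucket has hash functions $h_1,\dots,h_c:U\to[k]^D$. *History and adversary.* Initially all buckets of zone $z$ are empty, and all servers know their hash functions. In each of $T$ past periods the adversary, knowing all hash functions drawn so far, chooses the set of crashed servers, at most one bucket of zone $z$ to be re-encoded, and the set of items then stored in it; that bucket then gets new uniform independent hash functions and a new timestamp, and exactly the servers not crashed in that period take part. The timestamp of a server for a bucket is that of the last encoding of this bucket in which it took part. For the current period the adversary, knowing all hash functions, chooses the crashed servers and at most one lookup request per intact (not crashed) server (several servers may request the same item). *Probing Stage.* Each server $s$ with a request for $d$ asks $\kappa$ uniformly random intact servers for their timestamp of the bucket of $d$, and uses the largest timestamp $t$ among these and its own, together with the hash functions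 $h_1,\dots,h_c$ of timestamp $t$. It chooses $c$ intact servers $s(d_1),\dots,s(d_c)$ (all random choices are uniform and independent) and for each $i$ sends a probe $(d,i,t)$ along the unique path of length $D$ from $(D,s(d_i))$ to $(0,h_i(d))$. Levels are processed from $D$ down to $0$. A node is congested if it receives more than $\alpha c$ different probe messages $(d,i,t)$ (equal messages are combined); a congested node stops all probes it receives, and these fail; otherwise the probes pass that level. A probe that passes all levels, including level $0$, is answered by the server responsible for $h_i(d)$ if that server is intact and its timestamp for the bucket is $t$: with the piece if $d$ was stored in the encoding of timestamp $t$, and with "does not exist" otherwise. If the server is crashed or has another timestamp, the probe fails. If $s$ receives fewer than $c/3$ pieces, no "does not exist" answer and more than $2c/3$ failures, it declares its request to *belong to level* $\ell$, the smallest $\ell\in\{1,\dots,D\}$ such that at least $5c/6$ of its probes passed all levels $\ell'\ge\ell$. A data item belongs to level $\ell$ if some request for it does. **Lemma.** Let $\gamma=1/36$. For all $a,q,C\in\mathbb N$ there is $\alpha_0>0$ such that for all $\alpha\ge\alpha_0$ and $\varepsilon>0$ there is $n_0$ with the following property. Let $k\ge3$, $n=k^D\ge n_0$, $n\le m^a$,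 $c\ge 18\log_2 m$, $\kappa\ge\varepsilon\log_2 n$, $T\le n^q$, let $z$ be any zone, and suppose that in every period the adversary crashes fewer than $(\gamma/2)\cdot 2^{\log_k n}$ servers. Then, with probability at least $1-n^{-C}$, for every $\ell\in\{1,\dots,\log_k n\}$ simultaneously, the number of data items that belong to level $\ell$ after the Probing Stage in zone $z$ is at most $\gamma n/k^{\ell-1}$. -/

import Mathlib

namespace RoBuSt

/-- The constant `γ = 1/36`. -/
noncomputable def gam : ℝ := 1 / 36

/-- Parameters of the storage system: the `k`-ary butterfly of dimension `D` (so there are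
`n = k ^ D` servers and `D = log_k n`), the number `c` of pieces per data item, the number `κ` of
servers asked for their timestamp, the address length `Λ`, and the universe `keys` of keys. -/
structure Params where
  k : ℕ
  k_pos : 0 < k
  D : ℕ
  c : ℕ
  κ : ℕ
  Λ : ℕ
  keys : Finset (Fin Λ → Bool)

namespace Params

/-- The number of servers. -/
def n (P : Params) : ℕ := P.k ^ P.D

/-- The size of the universe of keys. -/
def m (P : Params) : ℕ := P.keys.card

end Params

/-- Servers are identified with the column labels of the butterfly: the server `x` emulates the
butterfly nodes `(0, x), …, (D, x)`. -/
abbrev Server (P : Params) : Type := Fin P.D → Fin P.k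

/-- Data items, identified by their keys. -/
abbrev Item (P : Params) : Type := {d : Fin P.Λ → Bool // d ∈ P.keys}

instance (P : Params) : Nonempty (Server P) := ⟨fun _ => ⟨0, P.k_pos⟩⟩

/-- Buckets of zone `z` in the binary tree of buckets. -/
abbrev Bucket (z : ℕ) : Type := Fin z → Bool

/-- The unique possible bucket of a data item in zone `z`, given by its first `z` address bits. -/
def bucketOf {P : Params} (z : Fin (P.Λ + 1)) (d : Item P) : Bucket z :=
  fun j => d.1 (Fin.castLE (Nat.lt_succ_iff.mp z.2) j)

/-! ### The butterfly -/

/-- The `D`-dimensional `k`-ary butterfly: `(i, x)` is joined to `(i + 1, y)` iff `x` and `y` agree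
outside the `(i + 1)`-st coordinate (which has index `i : Fin D`). -/
def butterfly (k D : ℕ) : SimpleGraph (Fin (D + 1) × (Fin D → Fin k)) :=
  SimpleGraph.fromRel fun u v =>
    (v.1 : ℕ) = (u.1 : ℕ) + 1 ∧ ∀ j : Fin D, (j : ℕ) ≠ (u.1 : ℕ) → u.2 j = v.2 j

/-- The label of the level-`ℓ` node on the path of length `D` from the node `(D, o)` to the node
`(0, x)`. -/
def pathNode {P : Params} (ℓ : ℕ) (o x : Server P) : Server P :=
  fun j => if (j : ℕ) < ℓ then o j else x j

/-- `pathNode` does describe the unique path of length `D` from `(D, o)` to `(0, x)`. -/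
theorem butterfly_path_iff {P : Params} (o x : Server P) (p : Fin (P.D + 1) → Server P) :
    (p (Fin.last P.D) = o ∧ p 0 = x ∧
      ∀ i : Fin P.D, (butterfly P.k P.D).Adj (i.castSucc, p i.castSucc) (i.succ, p i.succ)) ↔
      ∀ ℓ : Fin (P.D + 1), p ℓ = pathNode ℓ o x := by
  have hadj : ∀ i : Fin P.D,
      (butterfly P.k P.D).Adj (i.castSucc, p i.castSucc) (i.succ, p i.succ) ↔
        ∀ j : Fin P.D, (j : ℕ) ≠ (i : ℕ) → p i.castSucc j = p i.succ j := by
    intro i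
    simp only [butterfly, SimpleGraph.fromRel_adj, Fin.val_castSucc, Fin.val_succ, ne_eq,
      Prod.mk.injEq, true_and]
    constructor
    · rintro ⟨-, h | h⟩
      · exact h
      · omega
    · intro h
      refine ⟨?_, Or.inl h⟩
      rintro ⟨h1, -⟩
      have := congrArg Fin.val h1
      simp at this
  simp only [hadj]
  constructor
  · rintro ⟨ho, hx, hs⟩
    have up : ∀ (j : Fin P.D) (r : ℕ) (hr : r < P.D + 1), r ≤ (j : ℕ) → p ⟨r, hr⟩ j = x j := by
      intro j r
      induction r with
      | zero => intro hr _; rw [← hx]; rfl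
      | succ r ih =>
        intro hr hj
        rw [← ih (by omega) (by omega)]
        exact (hs ⟨r, by omega⟩ j (by simp only; omega)).symm
    have down : ∀ (j : Fin P.D) (r : ℕ) (hr : r ≤ P.D), (j : ℕ) < P.D - r →
        p ⟨P.D - r, by omega⟩ j = o j := by
      intro j r
      induction r with
      | zero => intro hr _; rw [← ho]; rfl
      | succ r ih =>
        intro hr hj
        rw [← ih (by omega) (by omega)]
        have h := hs ⟨P.D - (r + 1), by omega⟩ j (by simp only; omega)
        have e : (⟨P.D - r, by omega⟩ : Fin (P.D + 1)) =
            Fin.succ ⟨P.D - (r + 1), by omega⟩ := by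
          ext; simp; omega
        rw [e]
        exact h
    intro ℓ
    funext j
    unfold pathNode
    split_ifs with h
    · have hl := ℓ.2
      have := down j (P.D - ℓ) (by omega) (by omega)
      have e : (⟨P.D - (P.D - (ℓ : ℕ)), by omega⟩ : Fin (P.D + 1)) = ℓ := by
        ext; simp only; omega
      rwa [e] at this
    · exact up j ℓ ℓ.2 (by omega)
  · intro h
    refine ⟨?_, ?_, ?_⟩
    · rw [h]; funext j; simp [pathNode]
    · rw [h]; funext j; simp [pathNode]
    · intro i j hij
      rw [h, h]
      simp only [pathNode, Fin.val_castSucc, Fin.val_succ]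
      have : (j : ℕ) < i ↔ (j : ℕ) < i + 1 := by omega
      simp only [this]

/-! ### Hash functions, write history and adversary -/

/-- The hash functions `h_1, …, h_c` of one encoding. -/
abbrev HashFamily (P : Params) : Type := Fin P.c → Item P → Server P

/-- All hash functions drawn for buckets of the zone under consideration: entry `0` for the
initial (empty) buckets, entry `t + 1` for the bucket that is encoded in period `t`. -/
abbrev HashHistory (P : Params) (T : ℕ) : Type := Fin (T + 1) → HashFamily P

/-- An adaptive, batch-based adversary, as far as zone `z` is concerned. There are `T` past
write periods. In each of them, knowing all hash functions drawn before, it fixes the set of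
crashed servers, the bucket of zone `z` that is re-encoded (if any) and the data items that are
then stored in that bucket. For the current period, knowing all hash functions, it fixes the set of
crashed servers and the lookup requests handled in zone `z`, at most one for each intact
server. Distinct servers may ask for the same data item, and the item need not exist. -/
structure Adversary (P : Params) (z : ℕ) (T : ℕ) where
  pastCrashed : Fin T → HashHistory P T → Finset (Server P)
  encoded : Fin T → HashHistory P T → Option (Bucket z)
  content : Fin T → HashHistory P T → Finset (Item P)
  nonanticipating : ∀ (t : Fin T) (H H' : HashHistory P T),
    (∀ t' : Fin (T + 1), t' < t.succ → H t' = H' t') →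
      pastCrashed t H = pastCrashed t H' ∧ encoded t H = encoded t H' ∧ content t H = content t H'
  crashed : HashHistory P T → Finset (Server P)
  exists_intact : ∀ H, ∃ s, s ∉ crashed H
  request : HashHistory P T → Server P → Option (Item P)
  request_crashed : ∀ H, ∀ s ∈ crashed H, request H s = none

/-- In every period the adversary crashes fewer than `b` servers. -/
def Adversary.BlocksFewerThan {P : Params} {z T : ℕ} (A : Adversary P z T) (b : ℝ) : Prop :=
  ∀ H, (∀ t, ((A.pastCrashed t H).card : ℝ) < b) ∧ ((A.crashed H).card : ℝ) < b

section State

variable {P : Params} {T : ℕ} {z : Fin (P.Λ + 1)} (A : Adversary P z T) (H : HashHistory P T)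

/-- Server `x` took part in the encoding of bucket `b` with timestamp `t`. All servers know the
initial, empty buckets. -/
def TookPart (b : Bucket z) (x : Server P) (t : Fin (T + 1)) : Prop :=
  Fin.cases (motive := fun _ => Prop) True
    (fun t' : Fin T => A.encoded t' H = some b ∧ x ∉ A.pastCrashed t' H) t

open Classical in
/-- The timestamp that server `x` stores for bucket `b`: that of the last encoding of `b` in which
`x` took part. -/
noncomputable def timestamp (b : Bucket z) (x : Server P) : Fin (T + 1) :=
  (Finset.univ.filter fun t => TookPart A H b x t).sup id

/-- The data items stored in the bucket encoded with timestamp `t` (none initially). -/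
def stored (t : Fin (T + 1)) : Finset (Item P) :=
  Fin.cases (motive := fun _ => Finset (Item P)) ∅ (fun t' : Fin T => A.content t' H) t

end State

/-! ### The Probing Stage -/

/-- The random choices of the Probing Stage. Every server picks `κ` intact servers (to ask for
their timestamps) and `c` intact servers `s(d_1), …, s(d_c)` (from which its probes start). The
choices of servers without a lookup request are not used. -/
abbrev Choices (P : Params) (B : Finset (Server P)) : Type :=
  Server P → (Fin P.κ → {x : Server P // x ∉ B}) × (Fin P.c → {x : Server P // x ∉ B})

/-- A probe `(s, d, i)`: sent on behalf of the request of server `s` for piece `i` of item `d`. -/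
abbrev Probe (P : Params) : Type := Server P × Item P × Fin P.c

/-- Outcome of a probe as reported to the requesting server. -/
inductive Answer : Type
  | piece
  | notExists
  | fail

section Probing

variable {P : Params} {T : ℕ} {z : Fin (P.Λ + 1)} (α : ℝ) (A : Adversary P z T)
  (H : HashHistory P T) (ω : Choices P (A.crashed H))

/-- The most recent timestamp for the bucket of `d` that `s` knows after asking `κ` intact
servers; the probes of `s` use the hash functions of this timestamp. -/
noncomputable def acquired (s : Server P) (d : Item P) : Fin (T + 1) :=
  max (timestamp A H (bucketOf z d) s)
    (Finset.univ.sup fun j => timestamp A H (bucketOf z d) ((ω s).1 j).1)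

/-- The server responsible for the piece that a probe is looking for. -/
noncomputable def target (p : Probe P) : Server P :=
  H (acquired A H ω p.1 p.2.1) p.2.2 p.2.1

/-- The message carried by a probe: item, index of the piece, timestamp. Probes with equal
messages that meet in a node are combined. -/
noncomputable def message (p : Probe P) : Item P × Fin P.c × Fin (T + 1) :=
  (p.2.1, p.2.2, acquired A H ω p.1 p.2.1)

/-- The level-`ℓ` node on the path of a probe. -/
noncomputable def probeNode (ℓ : ℕ) (p : Probe P) : Server P :=
  pathNode ℓ ((ω p.1).2 p.2.2).1 (target A H ω p)

open Classical in
/-- If `R` is the set of probes that arrive at level `ℓ`: node `(ℓ, x)` receives more than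
`α c` different probe messages. -/
def Congested (R : Finset (Probe P)) (ℓ : ℕ) (x : Server P) : Prop :=
  α * (P.c : ℝ) <
    (((R.filter fun p => probeNode A H ω ℓ p = x).image (message A H ω)).card : ℝ)

open Classical in
/-- The probes that have not been stopped at one of the top `r` levels `D, D - 1, …, D - r + 1`. -/
noncomputable def alive : ℕ → Finset (Probe P)
  | 0 => Finset.univ.filter fun p => A.request H p.1 = some p.2.1
  | r + 1 => (alive r).filter fun p =>
      ¬ Congested α A H ω (alive r) (P.D - r) (probeNode A H ω (P.D - r) p)

/-- The probes that arrive at level `ℓ` (where `ℓ ≤ D`). -/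
noncomputable def arrivals (ℓ : ℕ) : Finset (Probe P) := alive α A H ω (P.D - ℓ)

open Classical in
/-- The probes that arrive at level `ℓ` and are not stopped there by congestion. For `ℓ ≥ 1` these
are the probes that successfully pass level `ℓ` and all higher levels. -/
noncomputable def passed (ℓ : ℕ) : Finset (Probe P) :=
  (arrivals α A H ω ℓ).filter fun p =>
    ¬ Congested α A H ω (arrivals α A H ω ℓ) ℓ (probeNode A H ω ℓ p)

open Classical in
/-- The answer to a probe. A probe not stopped by congestion is answered at level `0` by the server
responsible for the piece, provided that this server is intact and that its version of the bucket
has the timestamp of the probe; otherwise the probe fails. -/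
noncomputable def answer (p : Probe P) : Answer :=
  if p ∈ passed α A H ω 0 ∧ target A H ω p ∉ A.crashed H ∧
      timestamp A H (bucketOf z p.2.1) (target A H ω p) = acquired A H ω p.1 p.2.1 then
    if p.2.1 ∈ stored A H (acquired A H ω p.1 p.2.1) then Answer.piece else Answer.notExists
  else Answer.fail

open Classical in
/-- Number of probes of `s` for pieces of `d` with a given answer. -/
noncomputable def answerCount (s : Server P) (d : Item P) (r : Answer) : ℕ :=
  (Finset.univ.filter fun i : Fin P.c => answer α A H ω (s, d, i) = r).card

open Classical in
/-- Number of probes of `s` for pieces of `d` that are active at level `ℓ`. -/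
noncomputable def activeCount (s : Server P) (d : Item P) (ℓ : ℕ) : ℕ :=
  (Finset.univ.filter fun i : Fin P.c => (s, d, i) ∈ passed α A H ω ℓ).card

/-- Server `s` declares its request for `d` to belong to level `ℓ`: it got fewer than `c/3` pieces,
no `notExists` answer and more than `2c/3` failures, and `ℓ` is the smallest level in
`{1, …, D}` with at least `5c/6` active probes. -/
def RequestBelongs (s : Server P) (d : Item P) (ℓ : ℕ) : Prop :=
  A.request H s = some d ∧
    (answerCount α A H ω s d Answer.piece : ℝ) < (P.c : ℝ) / 3 ∧
    answerCount α A H ω s d Answer.notExists = 0 ∧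
    2 * (P.c : ℝ) / 3 < (answerCount α A H ω s d Answer.fail : ℝ) ∧
    IsLeast {j : ℕ | j ∈ Finset.Icc 1 P.D ∧
      5 * (P.c : ℝ) / 6 ≤ (activeCount α A H ω s d j : ℝ)} ℓ

open Classical in
/-- Number of data items that are declared to belong to level `ℓ` by some request for them. -/
noncomputable def levelCount (ℓ : ℕ) : ℕ :=
  (Finset.univ.filter fun d : Item P => ∃ s, RequestBelongs α A H ω s d ℓ).card

end Probing

/-- The joint law of the numbers of data items that belong to the levels after the Probing
Stage in zone `z`: all hash functions are uniform and independent, and after the adversary has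
reacted to them the servers make their choices uniformly and independently among the intact
servers. -/
noncomputable def levelCountLaw {P : Params} {T : ℕ} {z : Fin (P.Λ + 1)} (α : ℝ)
    (A : Adversary P z T) : PMF (ℕ → ℕ) :=
  (PMF.uniformOfFintype (HashHistory P T)).bind fun H =>
    haveI : Nonempty {x : Server P // x ∉ A.crashed H} :=
      let ⟨s, hs⟩ := A.exists_intact H
      ⟨⟨s, hs⟩⟩
    haveI : Fintype {x : Server P // x ∉ A.crashed H} := Fintype.ofFinite _
    (PMF.uniformOfFintype (Choices P (A.crashed H))).map fun ω ℓ => levelCount α A H ω ℓ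

end RoBuSt

/-! Suppose that every request uses the newest hash functions of its bucket. Then the target of each
probe is fixed by the hash history, and only the starting points are still random. A probe meets
node (j, y) iff its target agrees with y in the coordinates from j on and its start agrees with y
below j; the latter has probability at most 2/k^j, since at least half of the servers are intact. If
at most αc k^j/8 targets lie in the class of y at level j, the node therefore expects at most αc/4
probes, and a Chernoff bound excludes congestion at all such nodes at once (`Pr_not_balanced_le`).
So congestion is confined to heavy classes. As classes are nested, a covering argument shows that
the heavy classes together contain at most 8n/α servers (`card_heavyRegion_mul_le`).

An item at level ℓ > 1 has more than c/6 of its targets in heavy classes of level at least ℓ-1; an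
item at level 1 has more than c/6 of them on servers in heavy classes or crashed servers
(`levelCount_le`). The requests are chosen with knowledge of the hash functions, so this bad set
cannot be treated as fixed. But it is a union of classes of level j = ℓ-1, hence one of only
2^(k^(D-j)) sets. For a fixed small set the items behave independently, and each is bad with
probability exponentially small in c; that more than γ k^(D-j) items are bad is then so unlikely
that a union bound over all these sets succeeds (`Pr_not_expanding_le`).

Outdated servers are controlled by the bound on crashes: they form at most a (2/k)^D ≤ n^(-1/4)
fraction. Hence κ queries rarely all miss the newest timestamp (`Pr_not_acquiredLatest_le`).
Moreover the servers crashed in a past period are fixed before its hash functions are drawn, so few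
pieces of any item are assigned to servers absent from the encoding (`Pr_not_fewAbsent_le`). -/

namespace RoBuSt

/-! ### Finite uniform probability -/

section FiniteProbability

open Classical in
/-- The probability of `p` under the uniform distribution on a finite type. -/
noncomputable def Pr {Ω : Type*} [Fintype Ω] (p : Ω → Prop) : ℝ :=
  ((Finset.univ.filter p).card : ℝ) / Fintype.card Ω

variable {Ω Ω' ι β : Type*} [Fintype Ω] [Fintype Ω'] [Fintype ι] [Fintype β] [DecidableEq ι]

theorem Pr_eq (p : Ω → Prop) [DecidablePred p] :
    Pr p = ((Finset.univ.filter p).card : ℝ) / Fintype.card Ω := by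
  unfold Pr
  congr!

theorem Pr_nonneg (p : Ω → Prop) : 0 ≤ Pr p := by unfold Pr; positivity

theorem Pr_mono {p q : Ω → Prop} (h : ∀ ω, p ω → q ω) : Pr p ≤ Pr q := by
  classical
  simp only [Pr_eq]
  gcongr
  exact h _

theorem Pr_le_one (p : Ω → Prop) : Pr p ≤ 1 := by
  classical
  simp only [Pr_eq]
  apply div_le_one_of_le₀ _ (by positivity)
  exact_mod_cast Finset.card_le_univ _

theorem Pr_true [Nonempty Ω] : Pr (fun _ : Ω => True) = 1 := by
  classical
  simp only [Pr_eq]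
  simp

theorem Pr_not [Nonempty Ω] (p : Ω → Prop) : Pr (fun ω => ¬ p ω) = 1 - Pr p := by
  classical
  simp only [Pr_eq]
  have h : (Finset.univ.filter p).card + (Finset.univ.filter fun ω => ¬ p ω).card
      = Fintype.card Ω := Finset.card_filter_add_card_filter_not p
  have h' : ((Finset.univ.filter p).card : ℝ) + ((Finset.univ.filter fun ω => ¬ p ω).card : ℝ)
      = Fintype.card Ω := by exact_mod_cast h
  have : (Fintype.card Ω : ℝ) ≠ 0 := by simp
  rw [eq_sub_iff_add_eq, ← add_div, add_comm, h', div_self this]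

theorem Pr_exists_mem_le {κ : Type*} (s : Finset κ) (p : κ → Ω → Prop) :
    Pr (fun ω => ∃ i ∈ s, p i ω) ≤ ∑ i ∈ s, Pr (p i) := by
  classical
  simp only [Pr_eq]
  rw [← Finset.sum_div]
  gcongr
  have h : (Finset.univ.filter fun ω => ∃ i ∈ s, p i ω)
      = s.biUnion fun i => Finset.univ.filter (p i) := by ext; simp
  rw [h]
  exact_mod_cast Finset.card_biUnion_le

theorem Pr_exists_mem_le_card_mul {κ : Type*} (s : Finset κ) (p : κ → Ω → Prop) {δ : ℝ}
    (h : ∀ i ∈ s, Pr (p i) ≤ δ) : Pr (fun ω => ∃ i ∈ s, p i ω) ≤ s.card * δ :=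
  (Pr_exists_mem_le s p).trans (by simpa using Finset.sum_le_sum h)

theorem Pr_exists_le_card_mul {κ : Type*} [Fintype κ] (p : κ → Ω → Prop) {δ : ℝ}
    (h : ∀ i, Pr (p i) ≤ δ) : Pr (fun ω => ∃ i, p i ω) ≤ Fintype.card κ * δ := by
  simpa using Pr_exists_mem_le_card_mul Finset.univ p fun i _ => h i

theorem Pr_or_le (p q : Ω → Prop) : Pr (fun ω => p ω ∨ q ω) ≤ Pr p + Pr q := by
  classical
  simp only [Pr_eq]
  rw [← add_div]
  gcongr
  rw [Finset.filter_or]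
  exact_mod_cast Finset.card_union_le _ _

theorem Pr_equiv (e : Ω ≃ Ω') (p : Ω' → Prop) : Pr (fun ω => p (e ω)) = Pr p := by
  classical
  simp only [Pr_eq]
  rw [Fintype.card_congr e]
  congr 2
  apply Finset.card_bij (fun a _ => e a)
  · simp
  · simp
  · intro b hb
    exact ⟨e.symm b, by simpa using hb, by simp⟩

theorem Pr_snd [Nonempty Ω] (p : Ω' → Prop) : Pr (fun ω : Ω × Ω' => p ω.2) = Pr p := by
  classical
  simp only [Pr_eq]
  have h : (Finset.univ.filter fun ω : Ω × Ω' => p ω.2)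
      = (Finset.univ : Finset Ω) ×ˢ Finset.univ.filter p := by ext; simp
  rw [h, Finset.card_product, Fintype.card_prod, Finset.card_univ]
  push_cast
  rw [mul_div_mul_left]
  simp

theorem Pr_fst [Nonempty Ω'] (p : Ω → Prop) : Pr (fun ω : Ω × Ω' => p ω.1) = Pr p := by
  rw [← Pr_snd (Ω := Ω') p, ← Pr_equiv (Equiv.prodComm Ω Ω')]
  rfl

/-- Events about different coordinates of a product are independent. -/
theorem Pr_forall_pi (p : ι → β → Prop) :
    Pr (fun ω : ι → β => ∀ a, p a (ω a)) = ∏ a, Pr (p a) := by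
  classical
  simp only [Pr_eq]
  rw [Finset.prod_div_distrib]
  have h : (Finset.univ.filter fun ω : ι → β => ∀ a, p a (ω a))
      = Fintype.piFinset fun a => Finset.univ.filter (p a) := by
    ext; simp [Fintype.mem_piFinset]
  rw [h, Fintype.card_piFinset]
  simp

theorem Pr_forall_mem_pi [Nonempty β] (S : Finset ι) (p : ι → β → Prop) :
    Pr (fun ω : ι → β => ∀ a ∈ S, p a (ω a)) = ∏ a ∈ S, Pr (p a) := by
  classical
  rw [Pr_forall_pi fun a b => a ∈ S → p a b, ← Finset.prod_subset (Finset.subset_univ S)]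
  · apply Finset.prod_congr rfl
    intro a ha
    simp [ha]
  · intro a _ ha
    simp [ha, Pr_true]

/-- If resampling one coordinate makes `p` unlikely whatever the other coordinates are, then `p`
is unlikely. -/
theorem Pr_le_of_update (a : ι) (p : (ι → β) → Prop) {δ : ℝ} (hδ : 0 ≤ δ)
    (h : ∀ ω, Pr (fun b => p (Function.update ω a b)) ≤ δ) : Pr p ≤ δ := by
  classical
  rcases isEmpty_or_nonempty (ι → β) with he | ⟨⟨ω₀⟩⟩
  · unfold Pr
    simpa using hδ
  have : Nonempty β := ⟨ω₀ a⟩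
  have key : ∑ ω : ι → β, ((Finset.univ.filter fun b => p (Function.update ω a b)).card : ℝ)
      = Fintype.card β * ((Finset.univ.filter p).card : ℝ) := by
    -- Swapping the old and the new value at `a` permutes the pairs (ω, b), so resampling preserves
    -- the uniform measure.
    have e : Function.Involutive
        (fun x : (ι → β) × β => (Function.update x.1 a x.2, x.1 a)) := by
      rintro ⟨ω, b⟩
      simp
    have h1 : ∑ ω : ι → β, ((Finset.univ.filter fun b => p (Function.update ω a b)).card : ℝ)
        = ∑ x : (ι → β) × β, if p (Function.update x.1 a x.2) then (1 : ℝ) else 0 := by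
      rw [Fintype.sum_prod_type]
      simp
    have h2 : ∑ x : (ι → β) × β, (if p x.1 then (1 : ℝ) else 0)
        = Fintype.card β * ((Finset.univ.filter p).card : ℝ) := by
      rw [Fintype.sum_prod_type_right]
      simp
    rw [h1, ← h2]
    exact (Equiv.sum_comp (Function.Involutive.toPerm _ e)
      fun x : (ι → β) × β => if p x.1 then (1 : ℝ) else 0)
  have hb : (0 : ℝ) < Fintype.card β := by exact_mod_cast Fintype.card_pos
  have hc : (0 : ℝ) < Fintype.card (ι → β) := by exact_mod_cast Fintype.card_pos
  have hsum : ∑ ω : ι → β, ((Finset.univ.filter fun b => p (Function.update ω a b)).card : ℝ)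
      ≤ Fintype.card (ι → β) * (δ * Fintype.card β) := by
    have : ∀ ω ∈ (Finset.univ : Finset (ι → β)),
        ((Finset.univ.filter fun b => p (Function.update ω a b)).card : ℝ)
          ≤ δ * Fintype.card β := by
      intro ω _
      have := h ω
      unfold Pr at this
      rwa [div_le_iff₀ hb] at this
    simpa using Finset.sum_le_sum this
  rw [key] at hsum
  simp only [Pr_eq]
  rw [div_le_iff₀ hc]
  nlinarith

theorem Pr_eval_le (a : ι) (p : β → Prop) :
    Pr (fun ω : ι → β => p (ω a)) ≤ Pr p :=
  Pr_le_of_update a _ (Pr_nonneg p) fun ω => by simp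

/-- At least `r` of `c` independent events of probability at most `ρ` happen with probability at
most `2 ^ c * ρ ^ r`. -/
theorem Pr_le_card_filter_le [Nonempty β] (p : β → Prop) [DecidablePred p] {ρ : ℝ} (hρ : Pr p ≤ ρ) (hρ1 : ρ ≤ 1)
    (r : ℕ) :
    Pr (fun v : ι → β => r ≤ (Finset.univ.filter fun i => p (v i)).card)
      ≤ 2 ^ Fintype.card ι * ρ ^ r := by
  have h0 : 0 ≤ ρ := (Pr_nonneg p).trans hρ
  -- Union bound over the index sets of size at least r, of which there are at most 2^c.
  calc Pr (fun v : ι → β => r ≤ (Finset.univ.filter fun i => p (v i)).card)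
      ≤ Pr (fun v : ι → β => ∃ J ∈ (Finset.univ : Finset (Finset ι)).filter (fun J => r ≤ J.card),
          ∀ i ∈ J, p (v i)) := by
        apply Pr_mono
        intro v hv
        exact ⟨_, by simpa using hv, by simp⟩
    _ ≤ ((Finset.univ : Finset (Finset ι)).filter (fun J => r ≤ J.card)).card * ρ ^ r := by
        apply Pr_exists_mem_le_card_mul
        intro J hJ
        rw [Pr_forall_mem_pi J fun _ => p, Finset.prod_const]
        calc Pr p ^ J.card ≤ ρ ^ J.card := pow_le_pow_left₀ (Pr_nonneg p) hρ _
          _ ≤ ρ ^ r := pow_le_pow_of_le_one h0 hρ1 (by simpa using hJ)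
    _ ≤ 2 ^ Fintype.card ι * ρ ^ r := by
        gcongr
        have := Finset.card_filter_le (Finset.univ : Finset (Finset ι)) fun J => r ≤ J.card
        rw [Finset.card_univ, Fintype.card_finset] at this
        exact_mod_cast this

/-- A Chernoff bound for a sum of independent indicators. -/
theorem Pr_lt_card_filter_le [Nonempty β] (A : Finset ι) (p : ι → β → Prop)
    [∀ a, DecidablePred (p a)] {ρ : ℝ}
    (hρ : ∀ a, Pr (p a) ≤ ρ) (x : ℝ) :
    Pr (fun v : ι → β => x < ((A.filter fun a => p a (v a)).card : ℝ))
      ≤ Real.exp (A.card * ρ) / 2 ^ x := by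
  have hc : (0 : ℝ) < Fintype.card (ι → β) := by exact_mod_cast Fintype.card_pos
  have hb : (0 : ℝ) < Fintype.card β := by exact_mod_cast Fintype.card_pos
  -- Markov's inequality will be applied to 2^X, X the number of events that occur: independence
  -- gives E 2^X = ∏ (1 + Pr) ≤ exp(|A| ρ).
  have hmom : ∑ v : ι → β, (2 : ℝ) ^ (A.filter fun a => p a (v a)).card
      ≤ Fintype.card (ι → β) * Real.exp (A.card * ρ) := by
    have h1 : ∀ v : ι → β, (2 : ℝ) ^ (A.filter fun a => p a (v a)).card
        = ∏ a, (if a ∈ A ∧ p a (v a) then (2 : ℝ) else 1) := by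
      intro v
      rw [Finset.prod_ite]
      simp only [Finset.prod_const, one_pow, mul_one]
      congr 2
      ext a
      simp
    simp_rw [h1]
    have h2 := Finset.prod_univ_sum (fun _ : ι => (Finset.univ : Finset β))
      (fun a b => if a ∈ A ∧ p a b then (2 : ℝ) else 1)
    rw [Fintype.piFinset_univ] at h2
    rw [← h2]
    have h3 : ∀ a : ι, ∑ b, (if a ∈ A ∧ p a b then (2 : ℝ) else 1)
        ≤ Fintype.card β * Real.exp (if a ∈ A then ρ else 0) := by
      intro a
      by_cases ha : a ∈ A
      · have h4 : ∑ b, (if a ∈ A ∧ p a b then (2 : ℝ) else 1)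
            = Fintype.card β * (1 + Pr (p a)) := by
          have : ∀ b, (if a ∈ A ∧ p a b then (2 : ℝ) else 1) = 1 + if p a b then 1 else 0 := by
            intro b
            by_cases hp : p a b <;> simp [ha, hp]; norm_num
          simp_rw [this]
          rw [Finset.sum_add_distrib]
          simp only [Pr_eq]
          field_simp
          simp
        rw [h4]
        simp only [ha, if_true]
        gcongr
        have := Real.add_one_le_exp ρ
        linarith [hρ a]
      · simp [ha]
    calc ∏ a, ∑ b, (if a ∈ A ∧ p a b then (2 : ℝ) else 1)
        ≤ ∏ a : ι, (Fintype.card β * Real.exp (if a ∈ A then ρ else 0)) := by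
          apply Finset.prod_le_prod
          · intro a _
            apply Finset.sum_nonneg
            intro b _
            split_ifs <;> norm_num
          · intro a _
            exact h3 a
      _ = Fintype.card (ι → β) * Real.exp (A.card * ρ) := by
          rw [Finset.prod_mul_distrib, ← Real.exp_sum]
          simp
  have hx : (0 : ℝ) < 2 ^ x := Real.rpow_pos_of_pos (by norm_num) x
  simp only [Pr_eq]
  rw [div_le_div_iff₀ hc hx, mul_comm (Real.exp _)]
  refine le_trans ?_ hmom
  rw [← Finset.sum_filter_add_sum_filter_not Finset.univ
    (fun v : ι → β => x < ((A.filter fun a => p a (v a)).card : ℝ))]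
  apply le_add_of_le_of_nonneg
  · rw [← nsmul_eq_mul]
    apply Finset.card_nsmul_le_sum
    intro v hv
    rw [← Real.rpow_natCast]
    apply Real.rpow_le_rpow_of_exponent_le (by norm_num)
    simpa using (Finset.mem_filter.mp hv).2.le
  · positivity

theorem uniformOfFintype_toOuterMeasure [Nonempty Ω] (p : Ω → Prop) :
    (PMF.uniformOfFintype Ω).toOuterMeasure {ω | p ω} = ENNReal.ofReal (Pr p) := by
  classical
  rw [PMF.toOuterMeasure_uniformOfFintype_apply]
  simp only [Pr_eq]
  rw [ENNReal.ofReal_div_of_pos (by exact_mod_cast Fintype.card_pos)]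
  simp [Fintype.card_subtype]

/-- Lower bound for the probability of an event in a two-stage experiment. -/
theorem ofReal_le_bind_uniformOfFintype [Nonempty Ω] {γ : Type*} (f : Ω → PMF γ) (S : Set γ)
    (good : Ω → Prop) {δ δ' : ℝ} (hδ' : 0 ≤ δ') (h1 : Pr (fun ω => ¬ good ω) ≤ δ)
    (h2 : ∀ ω, good ω → ENNReal.ofReal (1 - δ') ≤ (f ω).toOuterMeasure S) :
    ENNReal.ofReal (1 - (δ + δ')) ≤ ((PMF.uniformOfFintype Ω).bind f).toOuterMeasure S := by
  classical
  rw [PMF.toOuterMeasure_bind_apply, tsum_fintype]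
  have hg : 1 - δ ≤ Pr good := by
    have := Pr_not good
    linarith
  calc ENNReal.ofReal (1 - (δ + δ'))
      ≤ ENNReal.ofReal (Pr good * (1 - δ')) := by
        rcases le_or_gt 0 (1 - (δ + δ')) with h | h
        · apply ENNReal.ofReal_le_ofReal
          have := Pr_le_one good
          nlinarith
        · rw [ENNReal.ofReal_of_nonpos h.le]
          exact zero_le
    _ = ENNReal.ofReal (Pr good) * ENNReal.ofReal (1 - δ') :=
        ENNReal.ofReal_mul (Pr_nonneg _)
    _ = ∑ ω ∈ Finset.univ.filter good,
          (PMF.uniformOfFintype Ω) ω * ENNReal.ofReal (1 - δ') := by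
        rw [← uniformOfFintype_toOuterMeasure, PMF.toOuterMeasure_apply_fintype, Finset.sum_mul,
          Finset.sum_filter]
        apply Finset.sum_congr rfl
        intro ω _
        by_cases h : good ω <;> simp [h]
    _ ≤ ∑ ω ∈ Finset.univ.filter good,
          (PMF.uniformOfFintype Ω) ω * (f ω).toOuterMeasure S := by
        apply Finset.sum_le_sum
        intro ω hω
        gcongr
        exact h2 ω (Finset.mem_filter.mp hω).2
    _ ≤ ∑ ω, (PMF.uniformOfFintype Ω) ω * (f ω).toOuterMeasure S :=
        Finset.sum_le_sum_of_subset (Finset.filter_subset _ _)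

end FiniteProbability

end RoBuSt

namespace RoBuSt

/-! ### Coordinate classes of servers -/

/-- `x` and `y` agree on all coordinates from `j` on. -/
def AgreeFrom {P : Params} (j : ℕ) (x y : Server P) : Prop :=
  ∀ l : Fin P.D, j ≤ (l : ℕ) → x l = y l

namespace AgreeFrom

variable {P : Params} {j j' : ℕ} {x y w : Server P}

theorem symm (h : AgreeFrom j x y) : AgreeFrom j y x := fun l hl => (h l hl).symm

theorem trans (h : AgreeFrom j x y) (h' : AgreeFrom j y w) : AgreeFrom j x w :=
  fun l hl => (h l hl).trans (h' l hl)

theorem mono (h : AgreeFrom j x y) (hj : j ≤ j') : AgreeFrom j' x y :=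
  fun l hl => h l (hj.trans hl)

end AgreeFrom

theorem card_server (P : Params) : Fintype.card (Server P) = P.n := by
  simp [Params.n]

theorem card_coordinates_ge {D : ℕ} (j : ℕ) :
    Fintype.card {l : Fin D // j ≤ (l : ℕ)} = D - j := by
  rw [Fintype.card_subtype]
  have h : (Finset.univ.filter fun l : Fin D => j ≤ (l : ℕ)).map Fin.valEmbedding
      = Finset.Ico j D := by
    ext a
    simp only [Finset.mem_map, Finset.mem_filter, Finset.mem_univ, true_and,
      Fin.valEmbedding_apply, Finset.mem_Ico]
    constructor
    · rintro ⟨b, hb, rfl⟩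
      exact ⟨hb, b.2⟩
    · rintro ⟨h1, h2⟩
      exact ⟨⟨a, h2⟩, h1, rfl⟩
  rw [← Finset.card_map Fin.valEmbedding, h, Nat.card_Ico]

open Classical in
theorem card_agreeFrom_le {P : Params} {j : ℕ} (hj : j ≤ P.D) (y : Server P) :
    (Finset.univ.filter fun x : Server P => AgreeFrom j x y).card ≤ P.k ^ j := by
  have hc : Fintype.card ({l : Fin P.D // (l : ℕ) < j} → Fin P.k) = P.k ^ j := by
    have h1 := Fintype.card_subtype_compl fun l : Fin P.D => j ≤ (l : ℕ)
    rw [card_coordinates_ge, Fintype.card_fin] at h1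
    have h2 : Fintype.card {l : Fin P.D // (l : ℕ) < j} = j := by
      rw [← Fintype.card_congr (Equiv.subtypeEquivRight fun l : Fin P.D =>
        (not_le : ¬ j ≤ (l : ℕ) ↔ _)), h1]
      omega
    rw [Fintype.card_fun, h2, Fintype.card_fin]
  rw [← hc, ← Finset.card_univ]
  apply Finset.card_le_card_of_injOn (fun x l => x l.1) (fun _ _ => Finset.mem_univ _)
  intro x hx x' hx' h
  simp only [Finset.coe_filter, Finset.mem_univ, true_and, Set.mem_ofPred_eq] at hx hx'
  funext l
  by_cases hl : (l : ℕ) < j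
  · exact congrFun h ⟨l, hl⟩
  · exact (hx.trans hx'.symm) l (not_lt.mp hl)

open Classical in
theorem card_agree_below_le {P : Params} {j : ℕ} (y : Server P) :
    (Finset.univ.filter fun x : Server P => ∀ l : Fin P.D, (l : ℕ) < j → x l = y l).card
      ≤ P.k ^ (P.D - j) := by
  have hc : Fintype.card ({l : Fin P.D // j ≤ (l : ℕ)} → Fin P.k) = P.k ^ (P.D - j) := by
    rw [Fintype.card_fun, card_coordinates_ge, Fintype.card_fin]
  rw [← hc, ← Finset.card_univ]
  apply Finset.card_le_card_of_injOn (fun x l => x l.1) (fun _ _ => Finset.mem_univ _)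
  intro x hx x' hx' h
  simp only [Finset.coe_filter, Finset.mem_univ, true_and, Set.mem_ofPred_eq] at hx hx'
  funext l
  by_cases hl : (l : ℕ) < j
  · exact (hx l hl).trans (hx' l hl).symm
  · exact congrFun h ⟨l, not_lt.mp hl⟩

/-! ### A maximal inequality -/

section Heavy

variable {P : Params} {ι : Type*} (A : Finset ι) (tgt : ι → Server P) (θ : ℝ)

open Classical in
/-- The class of `y` at level `j` is heavy if more than `θ k ^ j` of the points `tgt a` lie in it. -/
def Heavy (j : ℕ) (y : Server P) : Prop :=
  θ * (P.k : ℝ) ^ j < ((A.filter fun a => AgreeFrom j (tgt a) y).card : ℝ)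

open Classical in
/-- The union of all classes that are heavy at level `j` or above. -/
noncomputable def heavyRegion (j : ℕ) : Finset (Server P) :=
  Finset.univ.filter fun y => ∃ j', j ≤ j' ∧ j' ≤ P.D ∧ Heavy A tgt θ j' y

variable {A tgt θ}

theorem Heavy.of_agreeFrom {j : ℕ} {x y : Server P} (h : Heavy A tgt θ j x)
    (hxy : AgreeFrom j x y) : Heavy A tgt θ j y := by
  classical
  unfold Heavy at *
  have : (A.filter fun a => AgreeFrom j (tgt a) y) = A.filter fun a => AgreeFrom j (tgt a) x := by
    apply Finset.filter_congr
    intro a _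
    exact ⟨fun h => h.trans hxy.symm, fun h => h.trans hxy⟩
  rwa [this]

/-- Classes of higher level are coarser, so the region is a union of level-j classes. It is thus
determined by the coordinates from j on, which keeps the number of possible regions small. -/
theorem heavyRegion_of_agreeFrom {j : ℕ} {x y : Server P} (h : x ∈ heavyRegion A tgt θ j)
    (hxy : AgreeFrom j x y) : y ∈ heavyRegion A tgt θ j := by
  classical
  simp only [heavyRegion, Finset.mem_filter, Finset.mem_univ, true_and] at *
  obtain ⟨j', h1, h2, h3⟩ := h
  exact ⟨j', h1, h2, h3.of_agreeFrom (hxy.mono h1)⟩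

theorem heavyRegion_subset {i j : ℕ} (h : i ≤ j) :
    heavyRegion A tgt θ j ⊆ heavyRegion A tgt θ i := by
  classical
  intro x hx
  simp only [heavyRegion, Finset.mem_filter, Finset.mem_univ, true_and] at *
  obtain ⟨j', h1, h2⟩ := hx
  exact ⟨j', h.trans h1, h2⟩

/-- The union of all heavy classes has cardinality at most `|A| / θ`. -/
theorem card_heavyRegion_mul_le (j : ℕ) :
    ((heavyRegion A tgt θ j).card : ℝ) * θ ≤ A.card := by
  classical
  have hk : (0 : ℝ) < P.k := by exact_mod_cast P.k_pos
  -- Cover each point by its largest heavy class, of level `J x`; by nestedness these maximal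
  -- classes are equal or disjoint.
  have hmax : ∀ x ∈ heavyRegion A tgt θ j, ∃ J, J ≤ P.D ∧ Heavy A tgt θ J x ∧
      ∀ J', J' ≤ P.D → Heavy A tgt θ J' x → J' ≤ J := by
    intro x hx
    simp only [heavyRegion, Finset.mem_filter, Finset.mem_univ, true_and] at hx
    obtain ⟨j', -, h2, h3⟩ := hx
    have hne : ((Finset.range (P.D + 1)).filter fun i => Heavy A tgt θ i x).Nonempty :=
      ⟨j', by simp [h2, h3]⟩
    have hm := Finset.max'_mem _ hne
    rw [Finset.mem_filter, Finset.mem_range] at hm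
    refine ⟨_, by omega, hm.2, fun J' h1 h2 => Finset.le_max' _ _ ?_⟩
    simp [h1, h2]
  choose! J hJD hJ hJmax using hmax
  -- Double counting: each target gives weight k^(-J) to every point of the maximal class containing
  -- it, so each covered point collects at least θ, while each target spends at most 1.
  have h1 : ((heavyRegion A tgt θ j).card : ℝ) * θ ≤ ∑ x ∈ heavyRegion A tgt θ j,
      ∑ a ∈ A, if AgreeFrom (J x) (tgt a) x then ((P.k : ℝ) ^ J x)⁻¹ else 0 := by
    rw [← nsmul_eq_mul]
    apply Finset.card_nsmul_le_sum
    intro x hx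
    rw [← Finset.sum_filter, Finset.sum_const, nsmul_eq_mul, ← div_eq_mul_inv,
      le_div_iff₀ (by positivity)]
    exact (hJ x hx).le
  refine h1.trans ?_
  rw [Finset.sum_comm, ← mul_one (A.card : ℝ), ← nsmul_eq_mul]
  apply Finset.sum_le_card_nsmul
  intro a _
  rw [← Finset.sum_filter]
  rcases Finset.eq_empty_or_nonempty
    ((heavyRegion A tgt θ j).filter fun x => AgreeFrom (J x) (tgt a) x) with he | ⟨x₀, hx₀⟩
  · rw [he]
    simp
  rw [Finset.mem_filter] at hx₀
  -- If `J y < J x`, then x and y share the class of level `J x`, which is heavy, against the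
  -- maximality of `J y`.
  have hle : ∀ x ∈ heavyRegion A tgt θ j, ∀ y ∈ heavyRegion A tgt θ j,
      AgreeFrom (J x) (tgt a) x → AgreeFrom (J y) (tgt a) y → J x ≤ J y := by
    intro x hx y hy hax hay
    by_contra hlt
    push Not at hlt
    have hxy : AgreeFrom (J x) x y := hax.symm.trans (hay.mono hlt.le)
    have := hJmax y hy (J x) (hJD x hx) ((hJ x hx).of_agreeFrom hxy)
    omega
  have hconst : ∀ x ∈ (heavyRegion A tgt θ j).filter fun x => AgreeFrom (J x) (tgt a) x,
      ((P.k : ℝ) ^ J x)⁻¹ = ((P.k : ℝ) ^ J x₀)⁻¹ := by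
    intro x hx
    rw [Finset.mem_filter] at hx
    rw [le_antisymm (hle x hx.1 x₀ hx₀.1 hx.2 hx₀.2) (hle x₀ hx₀.1 x hx.1 hx₀.2 hx.2)]
  rw [Finset.sum_congr rfl hconst, Finset.sum_const, nsmul_eq_mul, ← div_eq_mul_inv,
    div_le_one (by positivity)]
  calc (((heavyRegion A tgt θ j).filter fun x => AgreeFrom (J x) (tgt a) x).card : ℝ)
      ≤ ((Finset.univ.filter fun x : Server P => AgreeFrom (J x₀) x (tgt a)).card : ℝ) := by
        norm_cast
        apply Finset.card_le_card
        intro x hx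
        rw [Finset.mem_filter] at hx
        have := le_antisymm (hle x hx.1 x₀ hx₀.1 hx.2 hx₀.2) (hle x₀ hx₀.1 x hx.1 hx₀.2 hx.2)
        rw [Finset.mem_filter]
        refine ⟨Finset.mem_univ _, ?_⟩
        rw [← this]
        exact hx.2.symm
    _ ≤ (P.k : ℝ) ^ J x₀ := by
        exact_mod_cast card_agreeFrom_le (hJD x₀ hx₀.1) (tgt a)

end Heavy

/-! ### The latest timestamps -/

section Deterministic

variable {P : Params} {T : ℕ} {z : Fin (P.Λ + 1)} (α : ℝ) (A : Adversary P z T)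
  (H : HashHistory P T)

open Classical in
/-- The timestamp of the last encoding of bucket `b`. -/
noncomputable def latest (b : Bucket z) : Fin (T + 1) :=
  (Finset.univ.filter fun t => Fin.cases (motive := fun _ => Prop) True
    (fun t' : Fin T => A.encoded t' H = some b) t).sup id

/-- The servers that did not take part in the encoding with timestamp `t`. -/
noncomputable def absent (t : Fin (T + 1)) : Finset (Server P) :=
  Fin.cases (motive := fun _ => Finset (Server P)) ∅ (fun t' : Fin T => A.pastCrashed t' H) t

theorem timestamp_le_latest (b : Bucket z) (x : Server P) :
    timestamp A H b x ≤ latest A H b := by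
  classical
  unfold timestamp latest
  apply Finset.sup_mono
  intro t ht
  simp only [Finset.mem_filter, Finset.mem_univ, true_and] at *
  unfold TookPart at ht
  induction t using Fin.cases with
  | zero => trivial
  | succ t' => exact ht.1

theorem timestamp_eq_latest (b : Bucket z) {x : Server P} (hx : x ∉ absent A H (latest A H b)) :
    timestamp A H b x = latest A H b := by
  classical
  apply le_antisymm (timestamp_le_latest A H b x)
  have hmem : latest A H b ∈ Finset.univ.filter fun t => Fin.cases (motive := fun _ => Prop) True
      (fun t' : Fin T => A.encoded t' H = some b) t := by
    -- Timestamp 0 always qualifies, so the supremum is attained by an actual encoding.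
    have hne : (Finset.univ.filter fun t : Fin (T + 1) => Fin.cases (motive := fun _ => Prop) True
        (fun t' : Fin T => A.encoded t' H = some b) t).Nonempty := ⟨0, by simp⟩
    obtain ⟨t, ht, he⟩ := Finset.exists_mem_eq_sup _ hne id
    unfold latest
    rw [he]
    exact ht
  have hp : TookPart A H b x (latest A H b) := by
    rw [Finset.mem_filter] at hmem
    replace hmem := hmem.2
    revert hmem hx
    generalize latest A H b = t
    induction t using Fin.cases with
    | zero => intros; trivial
    | succ t' =>
      intro h1 h2
      exact ⟨h2, h1⟩
  unfold timestamp
  exact Finset.le_sup (f := id) (Finset.mem_filter.mpr ⟨Finset.mem_univ _, hp⟩)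

variable {A H} in
theorem card_absent_lt {b : ℝ} (hA : A.BlocksFewerThan b) (t : Fin (T + 1)) :
    ((absent A H t).card : ℝ) < b := by
  induction t using Fin.cases with
  | zero =>
    have := (hA H).2
    simp only [absent, Fin.cases_zero, Finset.card_empty, Nat.cast_zero]
    exact lt_of_le_of_lt (by positivity) this
  | succ t' => exact (hA H).1 t'

variable (ω : Choices P (A.crashed H))

/-- Every request is served with the most recent hash functions. -/
def AcquiredLatest : Prop :=
  ∀ s d, A.request H s = some d → acquired A H ω s d = latest A H (bucketOf z d)

/-- No stored timestamp exceeds the latest one, so a single queried server that took part in the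
latest encoding suffices. -/
theorem acquired_eq_latest {s : Server P} {d : Item P} {i : Fin P.κ}
    (hi : ((ω s).1 i).1 ∉ absent A H (latest A H (bucketOf z d))) :
    acquired A H ω s d = latest A H (bucketOf z d) := by
  apply le_antisymm
  · unfold acquired
    apply max_le (timestamp_le_latest _ _ _ _)
    apply Finset.sup_le
    intro j _
    exact timestamp_le_latest _ _ _ _
  · rw [← timestamp_eq_latest A H _ hi]
    unfold acquired
    exact le_max_of_le_right (Finset.le_sup
      (f := fun j => timestamp A H (bucketOf z d) ((ω s).1 j).1) (Finset.mem_univ i))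

open Classical in
/-- The pairs `(s, i)` such that `s` has a request. -/
noncomputable def requests : Finset (Server P × Fin P.c) :=
  Finset.univ.filter fun p => (A.request H p.1).isSome

/-- The target of the `i`-th probe of `s` under the most recent hash functions. -/
noncomputable def latestTarget (p : Server P × Fin P.c) : Server P :=
  match A.request H p.1 with
  | some d => H (latest A H (bucketOf z d)) p.2 d
  | none => fun _ => ⟨0, P.k_pos⟩

theorem latestTarget_eq {s : Server P} {d : Item P} (h : A.request H s = some d) (i : Fin P.c) :
    latestTarget A H (s, i) = H (latest A H (bucketOf z d)) i d := by
  simp [latestTarget, h]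

theorem card_requests_le : (requests A H).card ≤ P.n * P.c := by
  classical
  refine (Finset.card_le_univ _).trans ?_
  rw [Fintype.card_prod, card_server, Fintype.card_fin]

/-- Classes of targets that attract more than `α c k ^ j / 8` probes. -/
abbrev HeavyNode (j : ℕ) (y : Server P) : Prop :=
  Heavy (requests A H) (latestTarget A H) (α * P.c / 8) j y

/-- The servers that lie in a heavy class of level at least `j`. -/
noncomputable abbrev overloaded (j : ℕ) : Finset (Server P) :=
  heavyRegion (requests A H) (latestTarget A H) (α * P.c / 8) j

open Classical in
/-- No node outside the heavy classes receives more than `α c` probes. -/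
def Balanced : Prop :=
  ∀ j ≤ P.D, ∀ y : Server P, ¬ HeavyNode α A H j y →
    ((((requests A H).filter fun p => AgreeFrom j (latestTarget A H p) y).filter fun p =>
      ∀ l : Fin P.D, (l : ℕ) < j → ((ω p.1).2 p.2).1 l = y l).card : ℝ) ≤ α * P.c

/-! ### Congestion is confined to heavy classes -/

variable {α A H ω}

theorem mem_alive_zero {p : Probe P} :
    p ∈ alive α A H ω 0 ↔ A.request H p.1 = some p.2.1 := by
  simp [alive]

theorem alive_subset_zero (r : ℕ) : alive α A H ω r ⊆ alive α A H ω 0 := by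
  classical
  induction r with
  | zero => exact Finset.Subset.refl _
  | succ r ih => exact (Finset.filter_subset _ _).trans ih

/-- From here on the targets depend on the hash history only, not on the choices of the Probing
Stage. -/
theorem target_eq (hω : AcquiredLatest A H ω) {p : Probe P} (hp : p ∈ alive α A H ω 0) :
    target A H ω p = latestTarget A H (p.1, p.2.2) := by
  rw [mem_alive_zero] at hp
  rw [latestTarget_eq A H hp]
  unfold target
  rw [hω _ _ hp]

/-- Combining and stopping probes only lowers the load, so it is enough to bound the load by all
probes that would visit the node. -/
theorem heavyNode_of_congested (hω : AcquiredLatest A H ω) (hb : Balanced α A H ω)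
    {R : Finset (Probe P)} (hR : R ⊆ alive α A H ω 0) {j : ℕ} (hj : j ≤ P.D) {y : Server P}
    (h : Congested α A H ω R j y) : HeavyNode α A H j y := by
  classical
  by_contra hn
  have h1 := hb j hj y hn
  unfold Congested at h
  refine absurd (h.trans_le ?_) (not_lt.mpr h1)
  norm_cast
  refine Finset.card_image_le.trans ?_
  -- A server has at most one request, so the pair (s, i) determines the probe.
  apply Finset.card_le_card_of_injOn (fun p => (p.1, p.2.2))
  · intro p hp
    simp only [Finset.coe_filter, Set.mem_ofPred_eq] at hp
    have hp0 := hR hp.1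
    have ht := target_eq hω hp0
    have hnode := hp.2
    rw [mem_alive_zero] at hp0
    unfold probeNode at hnode
    rw [ht] at hnode
    simp only [Finset.coe_filter, Set.mem_ofPred_eq, Finset.mem_filter, requests,
      Finset.mem_univ, true_and]
    refine ⟨⟨by simp [hp0], ?_⟩, ?_⟩
    · intro l hl
      rw [← hnode]
      simp [pathNode, not_lt.mpr hl]
    · intro l hl
      rw [← hnode]
      simp [pathNode, hl]
  · rintro ⟨s, d, i⟩ hp ⟨s', d', i'⟩ hp' h
    simp only [Finset.coe_filter, Set.mem_ofPred_eq] at hp hp'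
    have h1 := mem_alive_zero.mp (hR hp.1)
    have h2 := mem_alive_zero.mp (hR hp'.1)
    simp only [Prod.mk.injEq] at h h1 h2 ⊢
    obtain ⟨rfl, rfl⟩ := h
    rw [h1] at h2
    exact ⟨rfl, by simpa using h2, rfl⟩

/-- The probe was stopped at some level j' ≥ j. The congested node lies on its path and so agrees
with the target from coordinate j' on; hence the target lies in a heavy class of level j'. -/
theorem target_mem_overloaded (hω : AcquiredLatest A H ω) (hb : Balanced α A H ω) {s : Server P}
    {d : Item P} {i : Fin P.c} (hs : A.request H s = some d) {j : ℕ} (hj : j ≤ P.D)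
    (h : (s, d, i) ∉ passed α A H ω j) :
    H (latest A H (bucketOf z d)) i d ∈ overloaded α A H j := by
  classical
  have hp : (s, d, i) ∈ alive α A H ω 0 := mem_alive_zero.mpr hs
  have hcong : ∀ r, r ≤ P.D → (s, d, i) ∈ alive α A H ω r → (s, d, i) ∉ alive α A H ω (r + 1) →
      H (latest A H (bucketOf z d)) i d ∈ overloaded α A H (P.D - r) := by
    intro r hr h1 h2
    rw [alive, Finset.mem_filter, not_and, not_not] at h2
    have h3 := heavyNode_of_congested hω hb (alive_subset_zero r) (Nat.sub_le _ _) (h2 h1)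
    rw [← latestTarget_eq A H hs i]
    simp only [heavyRegion, Finset.mem_filter, Finset.mem_univ, true_and]
    refine ⟨P.D - r, le_rfl, Nat.sub_le _ _, h3.of_agreeFrom ?_⟩
    intro l hl
    unfold probeNode
    rw [target_eq hω hp]
    simp [pathNode, not_lt.mpr hl]
  have hblocked : ∀ r, r ≤ P.D → (s, d, i) ∉ alive α A H ω (r + 1) →
      H (latest A H (bucketOf z d)) i d ∈ overloaded α A H (P.D - r) := by
    intro r
    induction r with
    | zero =>
      intro _ hn
      exact hcong 0 (Nat.zero_le _) hp hn
    | succ r ih =>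
      intro hr hn
      by_cases hr' : (s, d, i) ∈ alive α A H ω (r + 1)
      · exact hcong _ hr hr' hn
      · exact heavyRegion_subset (by omega) (ih (by omega) hr')
  have hpass : passed α A H ω j = alive α A H ω (P.D - j + 1) := by
    unfold passed arrivals
    rw [alive, Nat.sub_sub_self hj]
  rw [hpass] at h
  have := hblocked (P.D - j) (by omega) h
  rwa [Nat.sub_sub_self hj] at this

/-- The maximal inequality with at most nc targets and θ = αc/8. -/
theorem card_overloaded_le (hα : 0 < α) (hc : 0 < P.c) (j : ℕ) :
    ((overloaded α A H j).card : ℝ) ≤ 8 * P.n / α := by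
  have h1 := card_heavyRegion_mul_le (A := requests A H) (tgt := latestTarget A H)
    (θ := α * P.c / 8) j
  have h2 : ((requests A H).card : ℝ) ≤ P.n * P.c := by exact_mod_cast card_requests_le A H
  have hc' : (0 : ℝ) < P.c := by exact_mod_cast hc
  rw [le_div_iff₀ hα]
  refine le_of_mul_le_mul_right ?_ hc'
  linarith

variable (H) in
open Classical in
/-- The hash functions spread the pieces of most data items over every not too small set that is
a union of classes. -/
def Expanding (x : ℝ) : Prop :=
  ∀ j < P.D, ∀ B : Finset (Server P), (∀ x y, x ∈ B → AgreeFrom j x y → y ∈ B) →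
    (B.card : ℝ) ≤ x →
    ((Finset.univ.filter fun d : Item P => ∃ t : Fin (T + 1),
      P.c < 6 * (Finset.univ.filter fun i => H t i d ∈ B).card).card : ℝ)
      ≤ gam * (P.k : ℝ) ^ (P.D - j)

variable (A H) in
open Classical in
/-- No encoding places many pieces of a data item on servers that did not take part in it. -/
def FewAbsent : Prop :=
  ∀ t d, 12 * (Finset.univ.filter fun i => H t i d ∈ absent A H t).card ≤ P.c

/-- A bad set `B` invariant under level-(ℓ-1) agreement is found that contains more than c/6 targets
of each item at level ℓ; expansion then bounds the number of such items. -/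
theorem levelCount_le (hω : AcquiredLatest A H ω) (hb : Balanced α A H ω) (hα : 0 < α)
    (hc : 0 < P.c) (hE : Expanding H (9 * P.n / α)) (hF : FewAbsent A H)
    (hcr : ((A.crashed H).card : ℝ) ≤ P.n / α) {ℓ : ℕ} (hℓ : ℓ ∈ Finset.Icc 1 P.D) :
    (levelCount α A H ω ℓ : ℝ) ≤ gam * P.n / (P.k : ℝ) ^ (ℓ - 1) := by
  classical
  rw [Finset.mem_Icc] at hℓ
  have hk : (0 : ℝ) < P.k := by exact_mod_cast P.k_pos
  have hgoal : gam * (P.n : ℝ) / (P.k : ℝ) ^ (ℓ - 1) = gam * (P.k : ℝ) ^ (P.D - (ℓ - 1)) := by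
    rw [Params.n, div_eq_iff (by positivity), mul_assoc, ← pow_add,
      Nat.sub_add_cancel (by omega)]
    push_cast
    rfl
  rw [hgoal]
  obtain ⟨B, hBinv, hBcard, hB⟩ : ∃ B : Finset (Server P),
      (∀ x y, x ∈ B → AgreeFrom (ℓ - 1) x y → y ∈ B) ∧ (B.card : ℝ) ≤ 9 * P.n / α ∧
      ∀ s d, RequestBelongs α A H ω s d ℓ → P.c < 6 * (Finset.univ.filter fun i =>
        H (latest A H (bucketOf z d)) i d ∈ B).card := by
    have hover := card_overloaded_le (A := A) (H := H) hα hc (ℓ - 1)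
    have hpos : 0 ≤ (P.n : ℝ) / α := by positivity
    have hsplit : 9 * (P.n : ℝ) / α = 8 * P.n / α + P.n / α := by ring
    rcases Nat.lt_or_ge 1 ℓ with h1 | h1
    -- Minimality of ℓ: fewer than 5c/6 probes pass level ℓ-1, so more than c/6 are stopped at or
    -- above it.
    · refine ⟨overloaded α A H (ℓ - 1), fun x y => heavyRegion_of_agreeFrom, by linarith, ?_⟩
      rintro s d ⟨hs, -, -, -, hleast⟩
      have hact : (activeCount α A H ω s d (ℓ - 1) : ℝ) < 5 * (P.c : ℝ) / 6 := by
        by_contra hcon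
        have := hleast.2 ⟨Finset.mem_Icc.mpr ⟨by omega, by omega⟩, not_lt.mp hcon⟩
        omega
      have hact' : 6 * activeCount α A H ω s d (ℓ - 1) < 5 * P.c := by
        have : (6 : ℝ) * activeCount α A H ω s d (ℓ - 1) < 5 * P.c := by linarith
        exact_mod_cast this
      have hsum := Finset.card_filter_add_card_filter_not (s := (Finset.univ : Finset (Fin P.c)))
        fun i => (s, d, i) ∈ passed α A H ω (ℓ - 1)
      rw [Finset.card_univ, Fintype.card_fin] at hsum
      have hle : (Finset.univ.filter fun i => (s, d, i) ∉ passed α A H ω (ℓ - 1)).card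
          ≤ (Finset.univ.filter fun i =>
            H (latest A H (bucketOf z d)) i d ∈ overloaded α A H (ℓ - 1)).card := by
        apply Finset.card_le_card
        intro i hi
        rw [Finset.mem_filter] at *
        exact ⟨hi.1, target_mem_overloaded hω hb hs (by omega) hi.2⟩
      unfold activeCount at hact'
      omega
    · obtain rfl : ℓ = 1 := by omega
      refine ⟨overloaded α A H 0 ∪ A.crashed H, ?_, ?_, ?_⟩
      · intro x y hx hxy
        have : x = y := funext fun l => hxy l (Nat.zero_le _)
        rwa [← this]
      · have : ((overloaded α A H 0 ∪ A.crashed H).card : ℝ)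
            ≤ (overloaded α A H 0).card + (A.crashed H).card := by
          exact_mod_cast Finset.card_union_le _ _
        simp only [Nat.sub_self] at hover
        linarith
      · rintro s d ⟨hs, -, -, hfail, -⟩
        have hfail' : 2 * P.c < 3 * answerCount α A H ω s d Answer.fail := by
          have : (2 : ℝ) * P.c < 3 * answerCount α A H ω s d Answer.fail := by linarith
          exact_mod_cast this
        -- A failure has three causes: congestion, a crashed target, or an outdated target. The last
        -- accounts for at most c/12 of more than 2c/3 failures, leaving more than 7c/12 > c/6
        -- targets in `B`.
        have hle : answerCount α A H ω s d Answer.fail ≤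
            (Finset.univ.filter fun i =>
              H (latest A H (bucketOf z d)) i d ∈ overloaded α A H 0 ∪ A.crashed H).card +
            (Finset.univ.filter fun i => H (latest A H (bucketOf z d)) i d
              ∈ absent A H (latest A H (bucketOf z d))).card := by
          refine le_trans (Finset.card_le_card ?_) (Finset.card_union_le _ _)
          intro i hi
          rw [Finset.mem_filter] at hi
          rw [Finset.mem_union, Finset.mem_filter, Finset.mem_filter, Finset.mem_union]
          by_contra hcon
          simp only [Finset.mem_univ, true_and, not_or] at hcon
          obtain ⟨⟨hc1, hc2⟩, hc3⟩ := hcon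
          have hp : (s, d, i) ∈ alive α A H ω 0 := mem_alive_zero.mpr hs
          have htgt : target A H ω (s, d, i) = H (latest A H (bucketOf z d)) i d := by
            rw [target_eq hω hp, latestTarget_eq A H hs]
          have hpass : (s, d, i) ∈ passed α A H ω 0 := by
            by_contra hn
            exact hc1 (target_mem_overloaded hω hb hs (Nat.zero_le _) hn)
          have hans := hi.2
          unfold answer at hans
          rw [if_pos ⟨hpass, by rwa [htgt], by
            rw [htgt, timestamp_eq_latest A H _ hc3, hω s d hs]⟩] at hans
          split_ifs at hans
        have := hF (latest A H (bucketOf z d)) d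
        omega
  refine le_trans ?_ (hE (ℓ - 1) (by omega) B hBinv hBcard)
  unfold levelCount
  norm_cast
  apply Finset.card_le_card
  intro d hd
  rw [Finset.mem_filter] at *
  obtain ⟨s, hs⟩ := hd.2
  exact ⟨hd.1, _, hB s d hs⟩

end Deterministic

end RoBuSt

namespace RoBuSt

/-! ### Probabilities of the events used above -/

section Events

/-- Few of many independent unlikely events happen. -/
theorem Pr_le_card_filter_le_pow {ι β : Type*} [Fintype ι] [DecidableEq ι] [Fintype β] [Nonempty β]
    (p : β → Prop) [DecidablePred p] {ρ : ℝ} (hρ : Pr p ≤ ρ) (M : ℕ) :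
    Pr (fun v : ι → β => M ≤ (Finset.univ.filter fun i => p (v i)).card)
      ≤ (Fintype.card ι * ρ) ^ M := by
  have h0 : 0 ≤ ρ := (Pr_nonneg p).trans hρ
  calc Pr (fun v : ι → β => M ≤ (Finset.univ.filter fun i => p (v i)).card)
      ≤ Pr (fun v : ι → β => ∃ J ∈ Finset.powersetCard M (Finset.univ : Finset ι),
          ∀ i ∈ J, p (v i)) := by
        apply Pr_mono
        intro v hv
        obtain ⟨J, hJ, hJM⟩ := Finset.exists_subset_card_eq hv
        refine ⟨J, by simp [Finset.mem_powersetCard, hJM], fun i hi => ?_⟩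
        simpa using hJ hi
    _ ≤ (Finset.powersetCard M (Finset.univ : Finset ι)).card * ρ ^ M := by
        apply Pr_exists_mem_le_card_mul
        intro J hJ
        rw [Pr_forall_mem_pi J fun _ => p, Finset.prod_const, (Finset.mem_powersetCard.mp hJ).2]
        exact pow_le_pow_left₀ (Pr_nonneg p) hρ _
    _ ≤ (Fintype.card ι * ρ) ^ M := by
        rw [mul_pow, Finset.card_powersetCard, Finset.card_univ]
        gcongr
        exact_mod_cast Nat.choose_le_pow _ _

theorem Pr_mem_finset {β : Type*} [Fintype β] [DecidableEq β] (B : Finset β) :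
    Pr (fun x => x ∈ B) = B.card / Fintype.card β := by
  simp [Pr_eq]

/-- Since b(c/b + 1) > c even with integer division, ρ ≤ 2^(-bK) turns the tail bound into 2^c ·
2^(-Kc). -/
theorem two_pow_mul_pow_le {c b K : ℕ} {ρ : ℝ} (hb : 0 < b) (h0 : 0 ≤ ρ)
    (hρ : ρ ≤ (1 / 2) ^ (b * K)) : (2 : ℝ) ^ c * ρ ^ (c / b + 1) ≤ 2 ^ c * (1 / 2) ^ (K * c) := by
  gcongr
  calc ρ ^ (c / b + 1) ≤ ((1 / 2) ^ (b * K)) ^ (c / b + 1) := by gcongr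
    _ = (1 / 2) ^ (b * K * (c / b + 1)) := (pow_mul _ _ _).symm
    _ ≤ (1 / 2) ^ (K * c) := by
        apply pow_le_pow_of_le_one (by norm_num) (by norm_num)
        have := Nat.lt_mul_div_succ c hb
        nlinarith

variable {P : Params} {T : ℕ} {z : Fin (P.Λ + 1)} {α : ℝ}

theorem n_pos (P : Params) : 0 < P.n := Nat.pow_pos P.k_pos

/-! ### Events about the hash functions -/

theorem Pr_not_expanding_le {K S : ℕ} {ρ : ℝ} (hc : 1 ≤ P.c) (hm : (P.m : ℝ) ≤ 2 ^ P.c)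
    (hT : ((T : ℝ) + 1) ≤ 2 ^ (S * P.c)) (hρ0 : 0 ≤ ρ)
    (hρ : ρ ≤ (1 / 2) ^ (6 * (38 + S + K))) :
    Pr (fun H : HashHistory P T => ¬ Expanding H (ρ * P.n)) ≤ P.D * (1 / 2) ^ (K * P.c) := by
  classical
  have hn : (0 : ℝ) < P.n := by exact_mod_cast n_pos P
  have hitem : Fintype.card (Item P) = P.m := by simp [Params.m]
  have hρ1 : ρ ≤ 1 := hρ.trans (pow_le_one₀ (by norm_num) (by norm_num))
  have hone : ∀ B : Finset (Server P), (B.card : ℝ) ≤ ρ * P.n →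
      Pr (fun g : Fin (T + 1) → Fin P.c → Server P =>
        ∃ t, P.c < 6 * (Finset.univ.filter fun i => g t i ∈ B).card)
        ≤ 2 ^ (S * P.c) * (2 ^ P.c * (1 / 2) ^ ((38 + S + K) * P.c)) := by
    intro B hB
    have hPB : Pr (fun x => x ∈ B) ≤ ρ := by
      rw [Pr_mem_finset, card_server]
      exact (div_le_iff₀ hn).mpr hB
    refine (Pr_exists_le_card_mul _ (δ := 2 ^ P.c * (1 / 2) ^ ((38 + S + K) * P.c))
      fun t => ?_).trans ?_
    · refine (Pr_eval_le t fun v : Fin P.c → Server P =>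
        P.c < 6 * (Finset.univ.filter fun i => v i ∈ B).card).trans ?_
      refine le_trans ?_ (two_pow_mul_pow_le (by norm_num : 0 < 6) hρ0 hρ)
      have := Pr_le_card_filter_le (ι := Fin P.c) _ hPB hρ1 (P.c / 6 + 1)
      rw [Fintype.card_fin] at this
      refine (Pr_mono fun v hv => ?_).trans this
      omega
    · rw [Fintype.card_fin]
      push_cast
      gcongr
  -- The threshold is the least integer above γ k^(D-j). The factor (1/2)^(k^(D-j)) pays for the
  -- union bound over invariant sets.
  have hB : ∀ j, ∀ B : Finset (Server P), (B.card : ℝ) ≤ ρ * P.n →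
      Pr (fun H : HashHistory P T => P.k ^ (P.D - j) / 36 + 1 ≤
        (Finset.univ.filter fun d : Item P => ∃ t : Fin (T + 1),
          P.c < 6 * (Finset.univ.filter fun i => H t i d ∈ B).card).card)
        ≤ (1 / 2) ^ P.k ^ (P.D - j) * (1 / 2) ^ (K * P.c) := by
    intro j B hB
    -- Regrouped by items, the history is a product over items, which makes their badness
    -- independent.
    let e : HashHistory P T ≃ (Item P → Fin (T + 1) → Fin P.c → Server P) :=
      { toFun := fun H d t i => H t i d
        invFun := fun G t i d => G d t i
        left_inv := fun _ => rfl
        right_inv := fun _ => rfl }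
    have h1 := Pr_le_card_filter_le_pow (ι := Item P) _ (hone B hB) (P.k ^ (P.D - j) / 36 + 1)
    rw [← Pr_equiv e, hitem] at h1
    refine h1.trans ?_
    set M := P.k ^ (P.D - j) / 36 + 1 with hM
    have hN : P.k ^ (P.D - j) ≤ 36 * M := by omega
    -- The exponent 38 + S + K: one c for m, one for the subsets of pieces, Sc for the timestamps,
    -- 36c because k^(D-j) ≤ 36M, and Kc as the remaining error.
    have hbase : (P.m : ℝ) * (2 ^ (S * P.c) * (2 ^ P.c * (1 / 2) ^ ((38 + S + K) * P.c)))
        ≤ (1 / 2) ^ (36 * P.c) * (1 / 2) ^ (K * P.c) := by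
      have hcancel : ∀ e : ℕ, (2 : ℝ) ^ e * (1 / 2) ^ e = 1 := fun e => by
        rw [← mul_pow]; norm_num
      calc (P.m : ℝ) * (2 ^ (S * P.c) * (2 ^ P.c * (1 / 2) ^ ((38 + S + K) * P.c)))
          ≤ 2 ^ P.c * (2 ^ (S * P.c) * (2 ^ P.c * (1 / 2) ^ ((38 + S + K) * P.c))) := by gcongr
        _ = (2 ^ P.c * (1 / 2) ^ P.c) * (2 ^ P.c * (1 / 2) ^ P.c)
              * (2 ^ (S * P.c) * (1 / 2) ^ (S * P.c))
              * ((1 / 2) ^ (36 * P.c) * (1 / 2) ^ (K * P.c)) := by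
            have : (38 + S + K) * P.c = P.c + P.c + S * P.c + 36 * P.c + K * P.c := by ring
            rw [this]
            simp only [pow_add]
            ring
        _ = _ := by rw [hcancel, hcancel]; ring
    calc ((P.m : ℝ) * (2 ^ (S * P.c) * (2 ^ P.c * (1 / 2) ^ ((38 + S + K) * P.c)))) ^ M
        ≤ ((1 / 2) ^ (36 * P.c) * (1 / 2) ^ (K * P.c)) ^ M := by gcongr
      _ = (1 / 2) ^ (36 * P.c * M) * (1 / 2) ^ (K * P.c * M) := by
          rw [mul_pow, ← pow_mul, ← pow_mul]
      _ ≤ (1 / 2) ^ P.k ^ (P.D - j) * (1 / 2) ^ (K * P.c) := by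
          apply mul_le_mul _ _ (by positivity) (by positivity)
          · apply pow_le_pow_of_le_one (by norm_num) (by norm_num)
            calc P.k ^ (P.D - j) ≤ 36 * M := hN
              _ ≤ 36 * P.c * M := by nlinarith
          · apply pow_le_pow_of_le_one (by norm_num) (by norm_num)
            exact Nat.le_mul_of_pos_right _ (by omega)
  -- Invariant sets are the preimages of sets of words in the last D-j coordinates.
  let pre : (j : ℕ) → Finset ({l : Fin P.D // j ≤ (l : ℕ)} → Fin P.k) → Finset (Server P) :=
    fun j B' => Finset.univ.filter fun x => (fun l => x l.1) ∈ B'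
  calc Pr (fun H : HashHistory P T => ¬ Expanding H (ρ * P.n))
      ≤ Pr (fun H : HashHistory P T => ∃ j ∈ Finset.range P.D, ∃ B', ((pre j B').card : ℝ) ≤ ρ * P.n ∧
          P.k ^ (P.D - j) / 36 + 1 ≤ (Finset.univ.filter fun d : Item P => ∃ t : Fin (T + 1),
            P.c < 6 * (Finset.univ.filter fun i => H t i d ∈ pre j B').card).card) := by
        apply Pr_mono
        intro H hH
        unfold Expanding at hH
        push Not at hH
        obtain ⟨j, hj, B, hinv, hcard, hbig⟩ := hH
        have hpre : pre j (B.image fun x l => x l.1) = B := by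
          ext x
          simp only [pre, Finset.mem_filter, Finset.mem_univ, true_and, Finset.mem_image]
          constructor
          · rintro ⟨y, hy, hyx⟩
            exact hinv y x hy fun l hl => congrFun hyx ⟨l, hl⟩
          · exact fun hx => ⟨x, hx, rfl⟩
        refine ⟨j, Finset.mem_range.mpr hj, B.image fun x l => x l.1, ?_, ?_⟩
        · rwa [hpre]
        · rw [hpre]
          set X := (Finset.univ.filter fun d : Item P => ∃ t : Fin (T + 1),
            P.c < 6 * (Finset.univ.filter fun i => H t i d ∈ B).card).card
          unfold gam at hbig
          have : P.k ^ (P.D - j) < 36 * X := by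
            have : ((P.k : ℝ) ^ (P.D - j)) < 36 * X := by linarith
            exact_mod_cast this
          omega
    _ ≤ (Finset.range P.D).card * (1 / 2) ^ (K * P.c) := by
        apply Pr_exists_mem_le_card_mul
        intro j hj
        refine (Pr_exists_le_card_mul _ (δ := (1 / 2) ^ P.k ^ (P.D - j) * (1 / 2) ^ (K * P.c))
          fun B' => ?_).trans (le_of_eq ?_)
        · by_cases h : ((pre j B').card : ℝ) ≤ ρ * P.n
          · exact (Pr_mono fun H hH => hH.2).trans (hB j _ h)
          · simp only [h, false_and]
            simp only [Pr_eq, Finset.filter_false, Finset.card_empty, Nat.cast_zero, zero_div]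
            positivity
        · rw [Fintype.card_finset, Fintype.card_fun, card_coordinates_ge, Fintype.card_fin,
            ← mul_assoc]
          push_cast
          rw [← mul_pow]
          norm_num
    _ = P.D * (1 / 2) ^ (K * P.c) := by rw [Finset.card_range]

/-- Here no union bound over sets is needed: the absent servers of an encoding are independent of
its own hash functions. -/
theorem Pr_not_fewAbsent_le {A : Adversary P z T} {b ρ : ℝ} {K S : ℕ}
    (hA : A.BlocksFewerThan b) (hm : (P.m : ℝ) ≤ 2 ^ P.c) (hT : ((T : ℝ) + 1) ≤ 2 ^ (S * P.c))
    (hρ0 : 0 ≤ ρ) (hρ : ρ ≤ (1 / 2) ^ (12 * (2 + S + K))) (hb : b ≤ ρ * P.n) :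
    Pr (fun H : HashHistory P T => ¬ FewAbsent A H) ≤ (1 / 2) ^ (K * P.c) := by
  classical
  have hn : (0 : ℝ) < P.n := by exact_mod_cast n_pos P
  have hitem : Fintype.card (Item P) = P.m := by simp [Params.m]
  have hρ1 : ρ ≤ 1 := hρ.trans (pow_le_one₀ (by norm_num) (by norm_num))
  have hone : ∀ (t : Fin (T + 1)) (d : Item P), Pr (fun H : HashHistory P T =>
      P.c < 12 * (Finset.univ.filter fun i => H t i d ∈ absent A H t).card)
      ≤ 2 ^ P.c * (1 / 2) ^ ((2 + S + K) * P.c) := by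
    intro t d
    induction t using Fin.cases with
    | zero =>
      simp only [absent, Fin.cases_zero, Finset.notMem_empty, Finset.filter_false,
        Finset.card_empty, mul_zero, Nat.not_lt_zero, Pr_eq, Nat.cast_zero, zero_div]
      positivity
    | succ t =>
      -- Only the hash functions of this encoding are resampled; by `nonanticipating` its absent set
      -- does not react.
      apply Pr_le_of_update t.succ _ (by positivity)
      intro H
      have hX : ∀ g, absent A (Function.update H t.succ g) t.succ = absent A H t.succ := by
        intro g
        refine (A.nonanticipating t _ _ fun t' ht' => ?_).1
        rw [Function.update_of_ne ht'.ne]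
      simp only [hX, Function.update_self]
      have hPX : Pr (fun f : Item P → Server P => f d ∈ absent A H t.succ) ≤ ρ := by
        refine (Pr_eval_le d fun x => x ∈ absent A H t.succ).trans ?_
        rw [Pr_mem_finset, card_server]
        exact (div_le_iff₀ hn).mpr ((card_absent_lt hA _).le.trans hb)
      refine le_trans ?_ (two_pow_mul_pow_le (by norm_num : 0 < 12) hρ0 hρ)
      have := Pr_le_card_filter_le (ι := Fin P.c) _ hPX hρ1 (P.c / 12 + 1)
      rw [Fintype.card_fin] at this
      refine (Pr_mono fun v hv => ?_).trans this
      omega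
  calc Pr (fun H : HashHistory P T => ¬ FewAbsent A H)
      ≤ Pr (fun H : HashHistory P T => ∃ t, ∃ d,
          P.c < 12 * (Finset.univ.filter fun i => H t i d ∈ absent A H t).card) := by
        apply Pr_mono
        intro H hH
        unfold FewAbsent at hH
        push Not at hH
        exact hH
    _ ≤ (T + 1) * (P.m * (2 ^ P.c * (1 / 2) ^ ((2 + S + K) * P.c))) := by
        refine (Pr_exists_le_card_mul _ fun t => Pr_exists_le_card_mul _ (hone t)).trans_eq ?_
        rw [hitem, Fintype.card_fin]
        push_cast
        rfl
    _ ≤ 2 ^ (S * P.c) * (2 ^ P.c * (2 ^ P.c * (1 / 2) ^ ((2 + S + K) * P.c))) := by gcongr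
    _ = (2 ^ P.c * (1 / 2) ^ P.c) * (2 ^ P.c * (1 / 2) ^ P.c)
          * (2 ^ (S * P.c) * (1 / 2) ^ (S * P.c)) * (1 / 2) ^ (K * P.c) := by
        have : (2 + S + K) * P.c = P.c + P.c + S * P.c + K * P.c := by ring
        rw [this]
        simp only [pow_add]
        ring
    _ = (1 / 2) ^ (K * P.c) := by
        have hcancel : ∀ e : ℕ, (2 : ℝ) ^ e * (1 / 2) ^ e = 1 := fun e => by
          rw [← mul_pow]; norm_num
        rw [hcancel, hcancel]
        ring

/-! ### Events about the choices of the Probing Stage -/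

variable {A : Adversary P z T} {H : HashHistory P T}
  [Fintype {x : Server P // x ∉ A.crashed H}]

theorem Pr_intact_mem_le {v : ℝ} (hv : 0 < v)
    (hI : v ≤ Fintype.card {x : Server P // x ∉ A.crashed H}) (S : Finset (Server P)) :
    Pr (fun x : {x : Server P // x ∉ A.crashed H} => x.1 ∈ S) ≤ S.card / v := by
  classical
  rw [Pr_eq]
  gcongr
  exact Finset.card_le_card_of_injOn Subtype.val (fun x hx => by simpa using hx)
    Subtype.val_injective.injOn

theorem Pr_not_acquiredLatest_le [Nonempty {x : Server P // x ∉ A.crashed H}] {b v : ℝ}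
    (hA : A.BlocksFewerThan b) (hv : 0 < v)
    (hI : v ≤ Fintype.card {x : Server P // x ∉ A.crashed H}) :
    Pr (fun ω : Choices P (A.crashed H) => ¬ AcquiredLatest A H ω) ≤ P.n * (b / v) ^ P.κ := by
  classical
  have hb0 : 0 ≤ b := le_trans (by positivity) (hA H).2.le
  calc Pr (fun ω : Choices P (A.crashed H) => ¬ AcquiredLatest A H ω)
      ≤ Pr (fun ω : Choices P (A.crashed H) => ∃ s, ∃ d, A.request H s = some d ∧
          ∀ i, ((ω s).1 i).1 ∈ absent A H (latest A H (bucketOf z d))) := by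
        apply Pr_mono
        intro ω hω
        unfold AcquiredLatest at hω
        push Not at hω
        obtain ⟨s, d, hs, hne⟩ := hω
        refine ⟨s, d, hs, fun i => ?_⟩
        by_contra hi
        exact hne (acquired_eq_latest A H ω hi)
    _ ≤ Fintype.card (Server P) * (b / v) ^ P.κ := by
        apply Pr_exists_le_card_mul
        intro s
        rcases hs : A.request H s with _ | d
        · simp only [reduceCtorEq, false_and, exists_false, Pr_eq, Finset.filter_false,
            Finset.card_empty, Nat.cast_zero, zero_div]
          positivity
        · simp only [Option.some.injEq, exists_eq_left']
          refine (Pr_eval_le s fun x : (Fin P.κ → {x : Server P // x ∉ A.crashed H}) ×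
            (Fin P.c → {x : Server P // x ∉ A.crashed H}) =>
              ∀ i, (x.1 i).1 ∈ absent A H (latest A H (bucketOf z d))).trans ?_
          rw [Pr_fst fun x : Fin P.κ → {x : Server P // x ∉ A.crashed H} =>
              ∀ i, (x i).1 ∈ absent A H (latest A H (bucketOf z d)),
            Pr_forall_pi fun _ (x : {x : Server P // x ∉ A.crashed H}) => x.1 ∈ absent A H (latest A H (bucketOf z d)),
            Finset.prod_const, Finset.card_univ, Fintype.card_fin]
          refine pow_le_pow_left₀ (Pr_nonneg _) ((Pr_intact_mem_le hv hI _).trans ?_) _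
          gcongr
          exact (card_absent_lt hA _).le
    _ = P.n * (b / v) ^ P.κ := by rw [card_server]

theorem Pr_not_balanced_le [Nonempty {x : Server P // x ∉ A.crashed H}] {K : ℕ}
    (hα : 2 * (K : ℝ) ≤ α)
    (hI : (P.n : ℝ) / 2 ≤ Fintype.card {x : Server P // x ∉ A.crashed H}) :
    Pr (fun ω : Choices P (A.crashed H) => ¬ Balanced α A H ω)
      ≤ (P.D + 1) * (P.n * (1 / 2) ^ (K * P.c)) := by
  classical
  have hn : (0 : ℝ) < P.n := by exact_mod_cast n_pos P
  have hk : (0 : ℝ) < P.k := by exact_mod_cast P.k_pos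
  have hα0 : 0 ≤ α := le_trans (by positivity) hα
  have hone : ∀ j ∈ Finset.range (P.D + 1), ∀ y : Server P, ¬ HeavyNode α A H j y →
      Pr (fun ω : Choices P (A.crashed H) => α * P.c <
        ((((requests A H).filter fun p => AgreeFrom j (latestTarget A H p) y).filter fun p =>
          ∀ l : Fin P.D, (l : ℕ) < j → ((ω p.1).2 p.2).1 l = y l).card : ℝ))
        ≤ (1 / 2) ^ (K * P.c) := by
    intro j hj y hy
    rw [Finset.mem_range, Nat.lt_succ_iff] at hj
    set Q := (requests A H).filter fun p => AgreeFrom j (latestTarget A H p) y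
    have hQ : (Q.card : ℝ) ≤ α * P.c / 8 * (P.k : ℝ) ^ j := not_lt.mp hy
    -- The starting points form a product over the pairs (s, i), independent of the timestamp
    -- queries.
    let e : Choices P (A.crashed H) ≃ (Server P → Fin P.κ → {x : Server P // x ∉ A.crashed H}) ×
        (Server P × Fin P.c → {x : Server P // x ∉ A.crashed H}) :=
      { toFun := fun ω => (fun s => (ω s).1, fun p => (ω p.1).2 p.2)
        invFun := fun x s => (x.1 s, fun i => x.2 (s, i))
        left_inv := fun _ => rfl
        right_inv := fun _ => rfl }
    have hp : Pr (fun x : {x : Server P // x ∉ A.crashed H} =>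
        ∀ l : Fin P.D, (l : ℕ) < j → x.1 l = y l) ≤ 2 / (P.k : ℝ) ^ j := by
      have h1 := Pr_intact_mem_le (half_pos hn) hI
        (Finset.univ.filter fun x : Server P => ∀ l : Fin P.D, (l : ℕ) < j → x l = y l)
      simp only [Finset.mem_filter, Finset.mem_univ, true_and] at h1
      refine h1.trans ?_
      have h2 : ((Finset.univ.filter fun x : Server P =>
          ∀ l : Fin P.D, (l : ℕ) < j → x l = y l).card : ℝ) ≤ (P.k : ℝ) ^ (P.D - j) := by
        exact_mod_cast card_agree_below_le y
      have h3 : (P.n : ℝ) = (P.k : ℝ) ^ (P.D - j) * (P.k : ℝ) ^ j := by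
        rw [← pow_add, Nat.sub_add_cancel hj, Params.n]
        push_cast
        rfl
      rw [div_le_div_iff₀ (half_pos hn) (by positivity), h3]
      have : (0 : ℝ) < (P.k : ℝ) ^ j := by positivity
      nlinarith
    have h1 := Pr_lt_card_filter_le Q (fun _ (x : {x : Server P // x ∉ A.crashed H}) =>
      ∀ l : Fin P.D, (l : ℕ) < j → x.1 l = y l) (fun _ => hp) (α * P.c)
    rw [← Pr_snd (Ω := Server P → Fin P.κ → {x : Server P // x ∉ A.crashed H}),
      ← Pr_equiv e] at h1
    refine h1.trans ?_
    have hexp : (Q.card : ℝ) * (2 / (P.k : ℝ) ^ j) ≤ α * P.c / 4 := by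
      rw [mul_div_assoc', div_le_iff₀ (by positivity)]
      linarith
    have hlog := Real.log_two_gt_d9
    have hx : 0 ≤ α * P.c := by positivity
    -- Since 1/4 ≤ (log 2)/2, the exponential is at most 2^(αc/2), and α ≥ 2K finishes.
    calc Real.exp (Q.card * (2 / (P.k : ℝ) ^ j)) / 2 ^ (α * P.c)
        ≤ Real.exp (Real.log 2 * (α * P.c / 2)) / 2 ^ (α * P.c) := by
          refine div_le_div_of_nonneg_right (Real.exp_le_exp.mpr (hexp.trans ?_)) (by positivity)
          nlinarith
      _ = 2 ^ (-(α * P.c / 2)) := by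
          rw [← Real.rpow_def_of_pos (by norm_num), ← Real.rpow_sub (by norm_num)]
          congr 1
          ring
      _ ≤ 2 ^ (-((K * P.c : ℕ) : ℝ)) := by
          apply Real.rpow_le_rpow_of_exponent_le (by norm_num)
          push_cast
          have : (0 : ℝ) ≤ P.c := by positivity
          nlinarith
      _ = (1 / 2) ^ (K * P.c) := by
          rw [Real.rpow_neg (by norm_num), Real.rpow_natCast, one_div, inv_pow]
  calc Pr (fun ω : Choices P (A.crashed H) => ¬ Balanced α A H ω)
      ≤ Pr (fun ω : Choices P (A.crashed H) => ∃ j ∈ Finset.range (P.D + 1), ∃ y : Server P,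
          ¬ HeavyNode α A H j y ∧ α * P.c <
          ((((requests A H).filter fun p => AgreeFrom j (latestTarget A H p) y).filter fun p =>
            ∀ l : Fin P.D, (l : ℕ) < j → ((ω p.1).2 p.2).1 l = y l).card : ℝ)) := by
        apply Pr_mono
        intro ω hω
        unfold Balanced at hω
        push Not at hω
        obtain ⟨j, hj, y, hy, h⟩ := hω
        exact ⟨j, Finset.mem_range.mpr (by omega), y, hy, h⟩
    _ ≤ (Finset.range (P.D + 1)).card * (Fintype.card (Server P) * (1 / 2) ^ (K * P.c)) := by
        apply Pr_exists_mem_le_card_mul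
        intro j hj
        apply Pr_exists_le_card_mul
        intro y
        by_cases hy : HeavyNode α A H j y
        · simp only [hy, not_true_eq_false, false_and, Pr_eq, Finset.filter_false,
            Finset.card_empty, Nat.cast_zero, zero_div]
          positivity
        · exact (Pr_mono fun ω hω => hω.2).trans (hone j hj y hy)
    _ = (P.D + 1) * (P.n * (1 / 2) ^ (K * P.c)) := by
        rw [Finset.card_range, card_server]
        push_cast
        rfl

end Events

end RoBuSt

namespace RoBuSt

/-! ### Choice of the parameters -/

/-- This is (2/k)^D ≤ n^(-1/4), which follows from 2^4 ≤ 3^3 ≤ k^3. -/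
theorem two_pow_D_div_n_pow_four_le {P : Params} (hk : 3 ≤ P.k) :
    ((2 : ℝ) ^ P.D / P.n) ^ 4 ≤ 1 / P.n := by
  have hn : (0 : ℝ) < P.n := by exact_mod_cast n_pos P
  rw [div_pow, div_le_div_iff₀ (by positivity) hn]
  have h : ((2 : ℝ) ^ P.D) ^ 4 ≤ (P.n : ℝ) ^ 3 := by
    have h1 : (16 : ℝ) ≤ (P.k : ℝ) ^ 3 := by
      have : (3 : ℝ) ≤ P.k := by exact_mod_cast hk
      calc (16 : ℝ) ≤ 3 ^ 3 := by norm_num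
        _ ≤ (P.k : ℝ) ^ 3 := by gcongr
    calc ((2 : ℝ) ^ P.D) ^ 4 = 16 ^ P.D := by rw [← pow_mul, mul_comm, pow_mul]; norm_num
      _ ≤ ((P.k : ℝ) ^ 3) ^ P.D := by gcongr
      _ = (P.n : ℝ) ^ 3 := by rw [Params.n, ← pow_mul, mul_comm, pow_mul]; push_cast; rfl
  nlinarith

theorem two_pow_D_div_n_le {P : Params} (hk : 3 ≤ P.k) {x : ℝ} (hx : 0 < x)
    (h : 1 / x ^ 4 ≤ P.n) : (2 : ℝ) ^ P.D / P.n ≤ x := by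
  have hn : (0 : ℝ) < P.n := by exact_mod_cast n_pos P
  rw [← pow_le_pow_iff_left₀ (by positivity) hx.le (by norm_num : 4 ≠ 0)]
  refine (two_pow_D_div_n_pow_four_le hk).trans ?_
  rw [div_le_iff₀ hn]
  rw [div_le_iff₀ (by positivity)] at h
  linarith

theorem D_lt_n {P : Params} (hk : 3 ≤ P.k) : P.D < P.n := Nat.lt_pow_self (by omega)

/-- The sum is at most 3n²u ≤ n⁴u; this is why C + 4 appears. -/
theorem probability_of_failure_le {n D C : ℕ} {u x y : ℝ} (hn : 2 ≤ n) (hD : D < n)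
    (hu : u = (1 / (n : ℝ)) ^ (C + 4)) (hx : x ≤ u) (hx0 : 0 ≤ x) (hy : y ≤ u) :
    (D * x + x) + (n * y + (D + 1) * (n * x)) ≤ 1 / (n : ℝ) ^ C := by
  have hn' : (2 : ℝ) ≤ n := by exact_mod_cast hn
  have hD' : (D : ℝ) + 1 ≤ n := by exact_mod_cast hD
  have hn0 : (0 : ℝ) < n := by linarith
  have hu0 : 0 ≤ u := hx0.trans hx
  have h1 : (D * x + x) + (n * y + (D + 1) * (n * x)) ≤ 3 * (n : ℝ) ^ 2 * u := by
    have e1 : (D * x + x) ≤ n * u := by nlinarith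
    have e2 : n * y ≤ n * u := by gcongr
    have e3 : (D + 1) * (n * x) ≤ n * (n * u) := by gcongr
    have e4 : n * u ≤ n * (n * u) := by
      have : u ≤ n * u := by nlinarith
      gcongr
    nlinarith
  refine h1.trans ?_
  have h2 : u * (n : ℝ) ^ 4 = 1 / (n : ℝ) ^ C := by
    rw [hu, one_div_pow, pow_add]
    field_simp
  rw [← h2]
  have h3 : (3 : ℝ) ≤ (n : ℝ) ^ 2 := by nlinarith
  have : 0 ≤ u * (n : ℝ) ^ 2 := by positivity
  nlinarith

theorem card_intact_ge {P : Params} {B : Finset (Server P)} [Fintype {x : Server P // x ∉ B}]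
    (hk : 3 ≤ P.k) (hB : (B.card : ℝ) ≤ gam / 2 * 2 ^ P.D) :
    (P.n : ℝ) / 2 ≤ Fintype.card {x : Server P // x ∉ B} := by
  classical
  have h : Fintype.card {x : Server P // x ∉ B} + B.card = P.n := by
    have h1 := Finset.card_filter_add_card_filter_not (s := (Finset.univ : Finset (Server P)))
      fun x => x ∈ B
    rw [Finset.card_univ, card_server, Finset.filter_mem_eq_inter, Finset.univ_inter] at h1
    rw [Fintype.card_subtype, ← h1, add_comm]
  have h' : (Fintype.card {x : Server P // x ∉ B} : ℝ) + B.card = P.n := by exact_mod_cast h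
  have h2 : (2 : ℝ) ^ P.D ≤ P.n := by
    rw [Params.n]
    push_cast
    gcongr
    exact_mod_cast (by omega : 2 ≤ P.k)
  have h3 : (0 : ℝ) < 2 ^ P.D := by positivity
  unfold gam at hB
  linarith

theorem two_le_m_of_n_le {P : Params} {a : ℕ} (hn : 2 ≤ P.n) (h : P.n ≤ P.m ^ a) : 2 ≤ P.m := by
  by_contra hlt
  have : P.m ^ a ≤ 1 := pow_le_one' (by omega) a
  omega

theorem m_le_two_pow_c {P : Params} (hm : 2 ≤ P.m)
    (hc : 18 * Real.logb 2 (P.m : ℝ) ≤ (P.c : ℝ)) : 1 ≤ P.c ∧ (P.m : ℝ) ≤ 2 ^ P.c := by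
  have hm' : (2 : ℝ) ≤ P.m := by exact_mod_cast hm
  have hlog : 1 ≤ Real.logb 2 (P.m : ℝ) := by
    rw [Real.le_logb_iff_rpow_le (by norm_num) (by linarith)]
    simpa using hm'
  constructor
  · have : (1 : ℝ) ≤ P.c := by linarith
    exact_mod_cast this
  · rw [← Real.rpow_natCast, ← Real.logb_le_iff_le_rpow (by norm_num) (by linarith)]
    linarith

end RoBuSt

theorem mainTheorem3 (a q C : ℕ) :
    ∃ α₀ : ℝ, 0 < α₀ ∧ ∀ α : ℝ, α₀ ≤ α → ∀ ε : ℝ, 0 < ε → ∃ n₀ : ℕ,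
      ∀ (P : RoBuSt.Params) (z : Fin (P.Λ + 1)) (T : ℕ) (A : RoBuSt.Adversary P z T),
        3 ≤ P.k → n₀ ≤ P.n → P.n ≤ P.m ^ a →
        18 * Real.logb 2 (P.m : ℝ) ≤ (P.c : ℝ) →
        ε * Real.logb 2 (P.n : ℝ) ≤ (P.κ : ℝ) →
        T ≤ P.n ^ q →
        A.BlocksFewerThan (RoBuSt.gam / 2 * 2 ^ P.D) →
        ENNReal.ofReal (1 - 1 / (P.n : ℝ) ^ C) ≤
          (RoBuSt.levelCountLaw α A).toOuterMeasure
            {N : ℕ → ℕ | ∀ ℓ ∈ Finset.Icc 1 P.D,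
              (N ℓ : ℝ) ≤ RoBuSt.gam * (P.n : ℝ) / (P.k : ℝ) ^ (ℓ - 1)} := by
  classical
  -- As n ≤ m^a ≤ 2^(ac), this K gives 2^(-Kc) ≤ n^(-(C+4)), and the next S gives T + 1 ≤ 2n^q ≤
  -- 2^(Sc).
  obtain ⟨K, hK⟩ : ∃ K, K = a * (C + 4) := ⟨_, rfl⟩
  obtain ⟨S, hS⟩ : ∃ S, S = a * q + 1 := ⟨_, rfl⟩
  -- The first summand makes the bad sets, of density at most 9/α, small enough for expansion; the
  -- second serves the Chernoff bound.
  refine ⟨9 * 2 ^ (6 * (38 + S + K)) + 2 * K, by positivity, fun α hα ε hε => ?_⟩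
  have h2pos : (0 : ℝ) < 2 ^ (6 * (38 + S + K)) := by positivity
  have hKnn : (0 : ℝ) ≤ K := by positivity
  have hα0 : 0 < α := by linarith
  -- With r = 2^D/n ≤ n^(-1/4), the terms ensure r ≤ 1/α, r ≤ 2^(-12(2+S+K)), κ ≥ 4(C+4) and n ≥ 2,
  -- in this order.
  refine ⟨⌈α ^ 4⌉₊ + 2 ^ (12 * (2 + S + K) * 4) + ⌈(2 : ℝ) ^ (4 * (C + 4) / ε)⌉₊ + 2, ?_⟩
  intro P z T A hk hn hna hc hκ hT hA
  obtain ⟨N₁, hN₁⟩ : ∃ N, N = ⌈α ^ 4⌉₊ := ⟨_, rfl⟩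
  obtain ⟨N₂, hN₂⟩ : ∃ N, N = 2 ^ (12 * (2 + S + K) * 4) := ⟨_, rfl⟩
  obtain ⟨N₃, hN₃⟩ : ∃ N, N = ⌈(2 : ℝ) ^ (4 * (C + 4) / ε)⌉₊ := ⟨_, rfl⟩
  rw [← hN₁, ← hN₂, ← hN₃] at hn
  have hn2 : 2 ≤ P.n := by omega
  have hn0 : (0 : ℝ) < P.n := by exact_mod_cast RoBuSt.n_pos P
  have hnα : α ^ 4 ≤ P.n := by
    refine (Nat.le_ceil _).trans ?_
    exact_mod_cast (by omega : ⌈α ^ 4⌉₊ ≤ P.n)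
  have hnK : (2 : ℝ) ^ (12 * (2 + S + K) * 4) ≤ P.n := by
    exact_mod_cast (by omega : 2 ^ (12 * (2 + S + K) * 4) ≤ P.n)
  have hnε : (2 : ℝ) ^ (4 * (C + 4) / ε) ≤ P.n := by
    refine (Nat.le_ceil _).trans ?_
    exact_mod_cast (by omega : ⌈(2 : ℝ) ^ (4 * (C + 4) / ε)⌉₊ ≤ P.n)
  obtain ⟨hc1, hm⟩ := RoBuSt.m_le_two_pow_c (RoBuSt.two_le_m_of_n_le hn2 hna) hc
  have hnc : (P.n : ℝ) ≤ 2 ^ (a * P.c) := by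
    calc (P.n : ℝ) ≤ (P.m : ℝ) ^ a := by exact_mod_cast hna
      _ ≤ (2 ^ P.c) ^ a := by gcongr
      _ = 2 ^ (a * P.c) := by rw [← pow_mul, mul_comm]
  have hTS : (T : ℝ) + 1 ≤ 2 ^ (S * P.c) := by
    have h1 : (T : ℝ) ≤ 2 ^ (a * P.c * q) := by
      calc (T : ℝ) ≤ (P.n : ℝ) ^ q := by exact_mod_cast hT
        _ ≤ (2 ^ (a * P.c)) ^ q := by gcongr
        _ = 2 ^ (a * P.c * q) := (pow_mul _ _ _).symm
    have h2 : (1 : ℝ) ≤ 2 ^ (a * P.c * q) := one_le_pow₀ (by norm_num)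
    have h3 : (2 : ℝ) ^ 1 ≤ 2 ^ P.c := pow_le_pow_right₀ (by norm_num) hc1
    calc (T : ℝ) + 1 ≤ 2 ^ (a * P.c * q) * 2 ^ 1 := by linarith
      _ ≤ 2 ^ (a * P.c * q) * 2 ^ P.c := by gcongr
      _ = 2 ^ (S * P.c) := by rw [← pow_add, hS]; ring_nf
  obtain ⟨u, hu⟩ : ∃ u, u = (1 / (P.n : ℝ)) ^ (C + 4) := ⟨_, rfl⟩
  have hxu : (1 / 2 : ℝ) ^ (K * P.c) ≤ u := by
    calc (1 / 2 : ℝ) ^ (K * P.c) = (1 / 2 ^ (a * P.c)) ^ (C + 4) := by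
          rw [hK, ← one_div_pow, ← pow_mul]
          ring_nf
      _ ≤ (1 / (P.n : ℝ)) ^ (C + 4) := by gcongr
      _ = u := hu.symm
  obtain ⟨r, hr⟩ : ∃ r, r = (2 : ℝ) ^ P.D / P.n := ⟨_, rfl⟩
  have hr0 : 0 ≤ r := by rw [hr]; positivity
  have hrn : r * P.n = 2 ^ P.D := by rw [hr]; field_simp
  have hr4 : r ^ 4 ≤ 1 / P.n := by rw [hr]; exact RoBuSt.two_pow_D_div_n_pow_four_le hk
  have hrK : r ≤ (1 / 2) ^ (12 * (2 + S + K)) := by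
    rw [hr]
    apply RoBuSt.two_pow_D_div_n_le hk (by positivity)
    rw [← pow_mul, one_div_pow, one_div_one_div]
    exact hnK
  have hrα : r ≤ 1 / α := by
    rw [hr]
    apply RoBuSt.two_pow_D_div_n_le hk (by positivity)
    rw [one_div_pow, one_div_one_div]
    exact hnα
  have hr1 : r ≤ 1 := hrK.trans (pow_le_one₀ (by norm_num) (by norm_num))
  have hb : RoBuSt.gam / 2 * 2 ^ P.D ≤ r * P.n := by
    have : (0 : ℝ) < 2 ^ P.D := by positivity
    rw [hrn]
    unfold RoBuSt.gam
    linarith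
  have hbv : RoBuSt.gam / 2 * 2 ^ P.D / ((P.n : ℝ) / 2) ≤ r := by
    rw [div_le_iff₀ (by positivity), ← hrn]
    have : 0 ≤ r * P.n := by positivity
    unfold RoBuSt.gam
    linarith
  have hbv0 : 0 ≤ RoBuSt.gam / 2 * 2 ^ P.D / ((P.n : ℝ) / 2) := by
    unfold RoBuSt.gam
    positivity
  have hκ4 : 4 * (C + 4) ≤ P.κ := by
    have h1 : 4 * (C + 4) / ε ≤ Real.logb 2 (P.n : ℝ) := by
      rwa [Real.le_logb_iff_rpow_le (by norm_num) hn0]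
    rw [div_le_iff₀ hε] at h1
    have : ((4 * (C + 4) : ℕ) : ℝ) ≤ P.κ := by
      push_cast
      linarith
    exact_mod_cast this
  have hyu : (RoBuSt.gam / 2 * 2 ^ P.D / ((P.n : ℝ) / 2)) ^ P.κ ≤ u := by
    calc (RoBuSt.gam / 2 * 2 ^ P.D / ((P.n : ℝ) / 2)) ^ P.κ ≤ r ^ P.κ := by gcongr
      _ ≤ r ^ (4 * (C + 4)) := pow_le_pow_of_le_one hr0 hr1 hκ4
      _ = (r ^ 4) ^ (C + 4) := pow_mul _ _ _
      _ ≤ (1 / (P.n : ℝ)) ^ (C + 4) := by gcongr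
      _ = u := hu.symm
  have hρ : 9 / α ≤ (1 / 2) ^ (6 * (38 + S + K)) := by
    rw [one_div_pow, div_le_div_iff₀ hα0 h2pos]
    linarith
  have hhist : RoBuSt.Pr (fun H : RoBuSt.HashHistory P T =>
      ¬ (RoBuSt.Expanding H (9 * P.n / α) ∧ RoBuSt.FewAbsent A H))
      ≤ P.D * (1 / 2) ^ (K * P.c) + (1 / 2) ^ (K * P.c) := by
    have h1 := RoBuSt.Pr_not_expanding_le (T := T) hc1 hm hTS (by positivity) hρ
    rw [div_mul_eq_mul_div] at h1
    have h2 := RoBuSt.Pr_not_fewAbsent_le hA hm hTS hr0 hrK hb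
    refine (RoBuSt.Pr_mono fun H hH => ?_).trans ((RoBuSt.Pr_or_le _ _).trans (add_le_add h1 h2))
    exact not_and_or.mp hH
  have hfail := RoBuSt.probability_of_failure_le (x := (1 / 2) ^ (K * P.c)) hn2
    (RoBuSt.D_lt_n hk) hu hxu (by positivity) hyu
  have hy0 : 0 ≤ (P.n : ℝ) * (RoBuSt.gam / 2 * 2 ^ P.D / ((P.n : ℝ) / 2)) ^ P.κ +
      (P.D + 1) * (P.n * (1 / 2) ^ (K * P.c)) := by positivity
  refine (ENNReal.ofReal_le_ofReal (by linarith)).trans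
    (RoBuSt.ofReal_le_bind_uniformOfFintype _ _ _ hy0 hhist ?_)
  rintro H ⟨hE, hF⟩
  have : Nonempty {x : RoBuSt.Server P // x ∉ A.crashed H} :=
    let ⟨s, hs⟩ := A.exists_intact H
    ⟨⟨s, hs⟩⟩
  let _ : Fintype {x : RoBuSt.Server P // x ∉ A.crashed H} := Fintype.ofFinite _
  have hI := RoBuSt.card_intact_ge hk (hA H).2.le
  have hcr : ((A.crashed H).card : ℝ) ≤ P.n / α := by
    refine ((hA H).2.le.trans hb).trans ?_
    calc r * P.n ≤ 1 / α * P.n := by gcongr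
      _ = P.n / α := by ring
  have hchoice : RoBuSt.Pr (fun ω : RoBuSt.Choices P (A.crashed H) =>
      ¬ (RoBuSt.AcquiredLatest A H ω ∧ RoBuSt.Balanced α A H ω))
      ≤ P.n * (RoBuSt.gam / 2 * 2 ^ P.D / ((P.n : ℝ) / 2)) ^ P.κ +
        (P.D + 1) * (P.n * (1 / 2) ^ (K * P.c)) := by
    have h1 := RoBuSt.Pr_not_acquiredLatest_le hA (half_pos hn0) hI
    have h2 := RoBuSt.Pr_not_balanced_le (α := α) (K := K) (by linarith) hI
    refine (RoBuSt.Pr_mono fun H hH => ?_).trans ((RoBuSt.Pr_or_le _ _).trans (add_le_add h1 h2))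
    exact not_and_or.mp hH
  rw [RoBuSt.Pr_not] at hchoice
  rw [PMF.toOuterMeasure_map_apply]
  refine (ENNReal.ofReal_le_ofReal (by linarith)).trans
    ((RoBuSt.uniformOfFintype_toOuterMeasure fun ω : RoBuSt.Choices P (A.crashed H) =>
      RoBuSt.AcquiredLatest A H ω ∧ RoBuSt.Balanced α A H ω).symm.le.trans
      (MeasureTheory.measure_mono ?_))
  rintro ω ⟨hω, hbal⟩ ℓ hℓ
  exact RoBuSt.levelCount_le hω hbal hα0 (by omega) hE hF hcr hℓ
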